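/- Let $\Sigma$ be a connected smooth surface (a $2$-manifold without boundary) with a smooth immersion $i:\Sigma\to\mathbb{R}^4$, identify $T_p\Sigma$ with the plane $di_p(T_p\Sigma)\subset\mathbb{R}^4$, and let $\Pi\subset\mathbb{R}^4$ be a two-dimensional linear subspace. The principal angles $0\le\theta_1\le\theta_2\le\pi/2$ between two planes $V,W$ are defined by $\cos\theta_1=\langle v_1,w_1\rangle=\max\{\langle v,w\rangle: v\in V,\ w\in W,\ |v|=|w|=1\}$ and $\cos\theta_2=\max\{\langle v,w\rangle: v\in V,\ w\in W,\ v\perp v_1,\ w\perp w_1,\ |v|=|w|=1\}$. Assume that there are constants $0<\theta_1<\theta_2<\pi/2$ which, for every $p\in\Sigma$, are the principal angles between $T_p\Sigma$ and $\Pi$. Let $\alpha$ be the second fundamental form of $\Sigma$, $\nabla$ the Levi-Civita connection of the induced metric, and $N_1(p)=\mathrm{span}\{\alpha(X,Y): X,Y\in T_p\Sigma\}$ the first normal space at $p$. Let $S_p$ be the symmetric endomorphism of $T_p\Sigma$ with $\langle S_pv,v'\rangle=\langle p_\Pi(v),p_\Pi(v')\rangle$, where $p_\Pi$ is the orthogonal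 projection onto $\Pi$; its eigenvalues are $\cos^2\theta_1$ and $\cos^2\theta_2$. For $j=1,2$ let $T_j$ be the smooth unit tangent vector field with $S T_j=\cos^2\theta_j\,T_j$, which is defined locally and up to sign. Assume that $\Sigma$ has no totally geodesic point, that is, $N_1(p)\neq 0$ for every $p\in\Sigma$. Then the following are equivalent: (i) $\Sigma$ is (locally) a composition in the sense of Dajczer, do Carmo and Tojeiro: every point of $\Sigma$ lies in the image of a smooth map $\varphi:U\to\Sigma$, with $U\subset\mathbb{R}^2$ open, such that $i\circ\varphi:U\to\mathbb{R}^4$ is an isometric immersion and $i\circ\varphi=F\circ g$ for smooth isometric immersions $g:U\to W\subset\mathbb{R}^3$ and $F:W\to\mathbb{R}^4$, with $W$ open in $\mathbb{R}^3$; (ii) the first normal space has rank one: $\dim N_1(p)=1$ for every $p\in\Sigma$; (iii) $T_1$ or $T_2$ is a geodesic vector field: $\nabla_{T_1}T_1=0$ on all of $\Sigma$, or $\nabla_{T_2}T_2=0$ on all of $\Sigma$. -/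

import Mathlib

open scoped Manifold ContDiff Topology RealInnerProductSpace

noncomputable section

/-- Euclidean space of dimension `n`, with its standard inner product. -/
abbrev Euc (n : ℕ) : Type := EuclideanSpace ℝ (Fin n)

/-! ### Principal angles between two planes of `ℝ⁴` -/

/-- `θ₁ ≤ θ₂` are the principal angles between the planes `V` and `W`:
`cos θ₁ = ⟪v₁, w₁⟫` is the maximum of `⟪v, w⟫` over unit vectors `v ∈ V`, `w ∈ W`, and `cos θ₂` is
the maximum of `⟪v, w⟫` over unit vectors `v ∈ V`, `w ∈ W` with `v ⟂ v₁` and `w ⟂ w₁`. -/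
def ArePrincipalAngles (V W : Submodule ℝ (Euc 4)) (θ₁ θ₂ : ℝ) : Prop :=
  0 ≤ θ₁ ∧ θ₁ ≤ θ₂ ∧ θ₂ ≤ Real.pi / 2 ∧
  ∃ v₁ ∈ V, ∃ w₁ ∈ W, ‖v₁‖ = 1 ∧ ‖w₁‖ = 1 ∧ ⟪v₁, w₁⟫ = Real.cos θ₁ ∧
    IsGreatest {c : ℝ | ∃ v ∈ V, ∃ w ∈ W, ‖v‖ = 1 ∧ ‖w‖ = 1 ∧ c = ⟪v, w⟫} (Real.cos θ₁) ∧
    IsGreatest {c : ℝ | ∃ v ∈ V, ∃ w ∈ W, ‖v‖ = 1 ∧ ‖w‖ = 1 ∧ ⟪v, v₁⟫ = 0 ∧ ⟪w, w₁⟫ = 0 ∧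
      c = ⟪v, w⟫} (Real.cos θ₂)

/-- The symmetric endomorphism `S_{WV}` of `V` representing the quadratic form `v ↦ ‖p_W v‖²`, where
`p_W` is the orthogonal projection onto `W`. -/
def angleOperator (W V : Submodule ℝ (Euc 4)) : V →ₗ[ℝ] V :=
  (V.orthogonalProjectionOnto : Euc 4 →ₗ[ℝ] V) ∘ₗ (W.starProjection : Euc 4 →ₗ[ℝ] Euc 4) ∘ₗ V.subtype

/-- The defining property of `S_{WV}`. -/
theorem inner_angleOperator (W V : Submodule ℝ (Euc 4)) (v v' : V) :
    ⟪angleOperator W V v, v'⟫ = ⟪W.starProjection (v : Euc 4), W.starProjection (v' : Euc 4)⟫ := by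
  rw [Submodule.inner_starProjection_left_eq_right,
    Submodule.starProjection_eq_self_iff.mpr (W.starProjection_apply_mem _)]
  simp [angleOperator, Submodule.inner_starProjection_left_eq_right]

/-! ### Immersed surfaces in `ℝ⁴` -/

section Surface

variable {M : Type*} [TopologicalSpace M] [ChartedSpace (Euc 2) M]

/-- A smooth immersion of the surface `M` into `ℝ⁴`. -/
structure IsSurfaceImmersion (i : M → Euc 4) : Prop where
  contMDiff : ContMDiff (𝓡 2) 𝓘(ℝ, Euc 4) ∞ i
  injective_mfderiv : ∀ p, Function.Injective (mfderiv (𝓡 2) 𝓘(ℝ, Euc 4) i p)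

/-- The differential at `p` of an `ℝ⁴`-valued map on the surface. -/
def surfDeriv (Y : M → Euc 4) (p : M) : Euc 2 →L[ℝ] Euc 4 :=
  mfderiv (𝓡 2) 𝓘(ℝ, Euc 4) Y p

/-- The tangent plane of the immersed surface at `p`, as a linear subspace of `ℝ⁴`. -/
def tangentPlane (i : M → Euc 4) (p : M) : Submodule ℝ (Euc 4) :=
  LinearMap.range (surfDeriv i p : Euc 2 →ₗ[ℝ] Euc 4)

/-- A smooth tangent vector field on the open set `V` of the surface, its values being viewed as
vectors of `ℝ⁴` through the differential of the immersion. -/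
structure IsTangentField (i : M → Euc 4) (V : Set M) (Y : M → Euc 4) : Prop where
  isOpen : IsOpen V
  contMDiffOn : ContMDiffOn (𝓡 2) 𝓘(ℝ, Euc 4) ∞ Y V
  mem_tangentPlane : ∀ q ∈ V, Y q ∈ tangentPlane i q

/-- The Levi-Civita derivative `∇_v Y` of the induced metric at `p`: the tangential part of the
Euclidean derivative of `Y` in the direction of the tangent vector `v` (of `M` at `p`). -/
def leviCivita (i : M → Euc 4) (Y : M → Euc 4) (p : M) (v : Euc 2) : Euc 4 :=
  (tangentPlane i p).starProjection (surfDeriv Y p v)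

/-- The second fundamental form `α(v, Y)` at `p`: the normal part of the Euclidean derivative
of the tangent field `Y` in the direction of the tangent vector `v` (of `M` at `p`). -/
def secondFundForm (i : M → Euc 4) (Y : M → Euc 4) (p : M) (v : Euc 2) : Euc 4 :=
  (tangentPlane i p)ᗮ.starProjection (surfDeriv Y p v)

/-- The first normal space `N₁(p)`: the span of all the values of the second fundamental form
at `p`. -/
def firstNormalSpace (i : M → Euc 4) (p : M) : Submodule ℝ (Euc 4) :=
  Submodule.span ℝ {w | ∃ (V : Set M) (Y : M → Euc 4) (v : Euc 2),
    p ∈ V ∧ IsTangentField i V Y ∧ w = secondFundForm i Y p v}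

/-- On `V`, the tangent field `T` is a field of unit eigenvectors of `S_{Π T_pΣ}` for the
eigenvalue `cos² θ`. For principal angles `θ₁ < θ₂ ≤ π/2` and `θ = θⱼ`, such fields exist near every
point and are unique up to sign on connected sets: they are the fields `Tⱼ`. -/
def IsPrincipalField (i : M → Euc 4) (P : Submodule ℝ (Euc 4)) (θ : ℝ) (V : Set M)
    (T : M → Euc 4) : Prop :=
  IsTangentField i V T ∧ ∀ q ∈ V, ‖T q‖ = 1 ∧
    ∃ h : T q ∈ tangentPlane i q,
      angleOperator P (tangentPlane i q) ⟨T q, h⟩ = (Real.cos θ) ^ 2 • ⟨T q, h⟩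

/-- On `V`, the tangent field `T` is geodesic: `∇_T T = 0`. -/
def IsGeodesicField (i : M → Euc 4) (V : Set M) (T : M → Euc 4) : Prop :=
  ∀ q ∈ V, ∀ v : Euc 2, surfDeriv i q v = T q → leviCivita i T q v = 0

/-- The principal direction field of the angle `θ`, which is defined locally and up to sign, is
geodesic. -/
def PrincipalDirectionGeodesic (i : M → Euc 4) (P : Submodule ℝ (Euc 4)) (θ : ℝ) : Prop :=
  ∀ p : M, ∃ (V : Set M) (T : M → Euc 4),
    p ∈ V ∧ IsPrincipalField i P θ V T ∧ IsGeodesicField i V T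

end Surface

/-! ### Compositions -/

/-- A smooth isometric immersion of the open subset `U` of `ℝᵐ` into `ℝⁿ`. -/
def IsIsometricImmersionOn {m n : ℕ} (f : Euc m → Euc n) (U : Set (Euc m)) : Prop :=
  IsOpen U ∧ ContDiffOn ℝ ∞ f U ∧ ∀ x ∈ U, ∀ u v, ⟪fderiv ℝ f x u, fderiv ℝ f x v⟫ = ⟪u, v⟫

/-- The isometric immersion `f : U ⊆ ℝ² → ℝ⁴` is a composition: `f = F ∘ g` for isometric immersions
`g : U → ℝ³` and `F : W ⊆ ℝ³ → ℝ⁴`. -/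
def IsCompositionOn (f : Euc 2 → Euc 4) (U : Set (Euc 2)) : Prop :=
  IsIsometricImmersionOn f U ∧
  ∃ (g : Euc 2 → Euc 3) (W : Set (Euc 3)) (F : Euc 3 → Euc 4),
    IsIsometricImmersionOn g U ∧ IsIsometricImmersionOn F W ∧ Set.MapsTo g U W ∧
    Set.EqOn f (F ∘ g) U

/-- The immersed surface is (locally) a composition: around every point it has a
parametrization `φ : U ⊆ ℝ² → M` for which `i ∘ φ` is an isometric immersion that is
a composition. -/
def IsSurfaceComposition {M : Type*} [TopologicalSpace M] [ChartedSpace (Euc 2) M]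
    (i : M → Euc 4) : Prop :=
  ∀ p : M, ∃ (U : Set (Euc 2)) (φ : Euc 2 → M),
    ContMDiffOn (𝓡 2) (𝓡 2) ∞ φ U ∧ p ∈ φ '' U ∧ IsCompositionOn (i ∘ φ) U

end

/-!
The unit principal fields `T`, `T'` and the unit normals `N`, `N'` in the planes spanned by `T`,
`p_Π T` and by `T'`, `p_Π T'` form an orthonormal frame along the surface. Constancy of the two
angles means that `Π` and `Πᗮ` are spanned by fixed rotations of this frame, so that all its
derivatives are expressed by two functions: the normal curvatures `κ`, `κ'` of `T` and `T'`. The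
first normal space is spanned by `κ N'` and `κ' N`, and `∇_T T` is a nonzero constant multiple of
`κ T'`. Hence away from totally geodesic points `dim N₁ = 1` means that exactly one of `κ`, `κ'`
vanishes, and by continuity and connectedness it is the same one everywhere.

If the surface factors through a hypersurface `F` isometric to an open subset of `ℝ³`, the Gauss
equations of both factors, together with the structure equations of the frame, exclude `κ κ' ≠ 0`.
If conversely `κ = 0`, then the surface is flat, and the lines through an isometric parametrization
in the direction `N' - a T'`, for a suitable constant `a`, sweep out a flat hypersurface of `ℝ⁴`
that contains the surface.
-/

noncomputable section

/-! ### Principal vectors of a pair of subspaces -/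

section InnerProductSpace

variable {F : Type*} [NormedAddCommGroup F] [InnerProductSpace ℝ F]

theorem sum_inner_smul_of_mem {ι : Type*} [Fintype ι] {W : Submodule ℝ F} [FiniteDimensional ℝ W]
    {b : ι → F} (hb : Orthonormal ℝ b) (hbW : ∀ j, b j ∈ W)
    (hcard : Fintype.card ι = Module.finrank ℝ W) {z : F} (hz : z ∈ W) :
    ∑ j, ⟪b j, z⟫ • b j = z := by
  have hspan : Submodule.span ℝ (Set.range b) = W :=
    Submodule.eq_of_le_of_finrank_eq (Submodule.span_le.mpr (Set.range_subset_iff.mpr hbW))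
      (by rw [finrank_span_eq_card hb.linearIndependent, hcard])
  rw [← hspan] at hz
  obtain ⟨c, rfl⟩ := (Submodule.mem_span_range_iff_exists_fun ℝ).mp hz
  simp only [hb.inner_right_fintype]

theorem inner_smul_add_inner_smul_of_mem {W : Submodule ℝ F} (hW : Module.finrank ℝ W = 2)
    {a b z : F} (ha : a ∈ W) (hb : b ∈ W) (ha₁ : ‖a‖ = 1) (hb₁ : ‖b‖ = 1) (hab : ⟪a, b⟫ = 0)
    (hz : z ∈ W) : ⟪a, z⟫ • a + ⟪b, z⟫ • b = z := by
  have : FiniteDimensional ℝ W := FiniteDimensional.of_finrank_eq_succ hW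
  have ho : Orthonormal ℝ ![a, b] := by
    rw [orthonormal_vecCons_iff]
    simp [ha₁, hb₁, hab]
  simpa using sum_inner_smul_of_mem ho (Fin.forall_fin_two.mpr ⟨ha, hb⟩) (by simp [hW]) hz

/-- The equality case of the Cauchy–Schwarz inequality for `w` and the projection of `v`. -/
theorem starProjection_eq_smul_of_forall_inner_le {W : Submodule ℝ F} [W.HasOrthogonalProjection]
    {v w w₁ : F} (hw : w ∈ W) (hw₁ : ‖w‖ = 1) (hv : ⟪W.starProjection v, w₁⟫ = 0)
    (hmax : ∀ u ∈ W, ‖u‖ = 1 → ⟪u, w₁⟫ = 0 → ⟪v, u⟫ ≤ ⟪v, w⟫) :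
    W.starProjection v = ⟪v, w⟫ • w := by
  have inner_eq {u : F} (hu : u ∈ W) : ⟪v, u⟫ = ⟪W.starProjection v, u⟫ := by
    rw [W.inner_starProjection_left_eq_right, W.starProjection_eq_self_iff.mpr hu]
  set p := W.starProjection v
  have hpW : p ∈ W := W.starProjection_apply_mem v
  rw [inner_eq hw]
  rcases eq_or_ne p 0 with hp | hp
  · rw [hp, inner_zero_left, zero_smul]
  have hle : ‖p‖ ≤ ⟪p, w⟫ := by
    have := hmax (‖p‖⁻¹ • p) (W.smul_mem _ hpW) (norm_smul_inv_norm hp)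
      (by rw [real_inner_smul_left, hv, mul_zero])
    rwa [inner_eq hw, inner_eq (W.smul_mem _ hpW), real_inner_smul_right,
      real_inner_self_eq_norm_mul_norm, inv_mul_cancel_left₀ (norm_ne_zero_iff.mpr hp)] at this
  have heq : ⟪p, w⟫ = ‖p‖ * ‖w‖ := (real_inner_le_norm p w).antisymm (by rwa [hw₁, mul_one])
  have hpw := inner_eq_norm_mul_iff_real.mp heq
  rwa [hw₁, one_smul, ← mul_one ‖p‖, ← hw₁, ← heq] at hpw

end InnerProductSpace

/-- `T` is a principal vector of `V` for the angle `θ` with `P`: a unit eigenvector of the angle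
operator for the eigenvalue `cos² θ`, in the form used in `IsPrincipalField`. -/
def IsPrincipalUnit (V P : Submodule ℝ (Euc 4)) (θ : ℝ) (T : Euc 4) : Prop :=
  ‖T‖ = 1 ∧ ∃ h : T ∈ V, angleOperator P V ⟨T, h⟩ = Real.cos θ ^ 2 • ⟨T, h⟩

/-- Angles for which both principal directions and their normal companions are defined: neither
plane contains or is orthogonal to a principal vector of the other, and the two eigenvalues of the
angle operator are distinct. -/
structure GenericAngles (θ θ' : ℝ) : Prop where
  cos_ne_zero : Real.cos θ ≠ 0
  cos_ne_zero' : Real.cos θ' ≠ 0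
  sin_ne_zero : Real.sin θ ≠ 0
  sin_ne_zero' : Real.sin θ' ≠ 0
  cos_sq_ne : Real.cos θ ^ 2 ≠ Real.cos θ' ^ 2

theorem GenericAngles.of_pos_of_lt_of_lt_pi_div_two {θ θ' : ℝ} (hθ : 0 < θ) (hlt : θ < θ')
    (hθ' : θ' < Real.pi / 2) : GenericAngles θ θ' := by
  have hcos : Real.cos θ' < Real.cos θ :=
    Real.cos_lt_cos_of_nonneg_of_le_pi_div_two hθ.le hθ'.le hlt
  have hcos' : 0 < Real.cos θ' := Real.cos_pos_of_mem_Ioo ⟨by linarith, hθ'⟩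
  exact ⟨(hcos'.trans hcos).ne', hcos'.ne', (Real.sin_pos_of_pos_of_lt_pi hθ (by linarith)).ne',
    (Real.sin_pos_of_pos_of_lt_pi (hθ.trans hlt) (by linarith)).ne',
    (pow_lt_pow_left₀ hcos hcos'.le two_ne_zero).ne'⟩

theorem GenericAngles.swap {θ θ' : ℝ} (h : GenericAngles θ θ') : GenericAngles θ' θ :=
  ⟨h.cos_ne_zero', h.cos_ne_zero, h.sin_ne_zero', h.sin_ne_zero, h.cos_sq_ne.symm⟩

/-- The unit normal vector in the plane of a principal vector `T` and its projection to `P`; the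
rotation by `θ` in this plane takes `P` and `Pᗮ` to the lines of `T` and of this vector. -/
def principalNormal (P : Submodule ℝ (Euc 4)) (θ : ℝ) (T : Euc 4) : Euc 4 :=
  (Real.sin θ)⁻¹ • (Real.cos θ • T - (Real.cos θ)⁻¹ • P.starProjection T)

section PrincipalUnit

variable {V P : Submodule ℝ (Euc 4)} {θ θ' : ℝ} {T T' : Euc 4}

theorem isPrincipalUnit_iff : IsPrincipalUnit V P θ T ↔
    T ∈ V ∧ ‖T‖ = 1 ∧ V.starProjection (P.starProjection T) = Real.cos θ ^ 2 • T := by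
  constructor
  · rintro ⟨hT, hV, h⟩
    exact ⟨hV, hT, congrArg Subtype.val h⟩
  · rintro ⟨hV, hT, h⟩
    exact ⟨hT, hV, Subtype.ext h⟩

theorem ArePrincipalAngles.exists_isPrincipalUnit (h : ArePrincipalAngles V P θ θ') :
    (∃ T, IsPrincipalUnit V P θ T) ∧ ∃ T, IsPrincipalUnit V P θ' T := by
  obtain ⟨-, -, -, v₁, hv₁, w₁, hw₁, hv₁n, hw₁n, hc, ⟨-, hmax⟩,
    ⟨v₂, hv₂, w₂, hw₂, hv₂n, hw₂n, hv₂₁, hw₂₁, hc'⟩, hmax'⟩ := h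
  have hPv₁ : P.starProjection v₁ = Real.cos θ • w₁ := by
    rw [← hc]
    refine starProjection_eq_smul_of_forall_inner_le hw₁ hw₁n (inner_zero_right _) ?_
    exact fun u hu hun _ ↦ hc ▸ hmax ⟨v₁, hv₁, u, hu, hv₁n, hun, rfl⟩
  have hVw₁ : V.starProjection w₁ = Real.cos θ • v₁ := by
    rw [← hc, real_inner_comm]
    refine starProjection_eq_smul_of_forall_inner_le hv₁ hv₁n (inner_zero_right _) ?_
    intro u hu hun _
    rw [real_inner_comm, real_inner_comm v₁, hc]
    exact hmax ⟨u, hu, w₁, hw₁, hun, hw₁n, rfl⟩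
  have hPv₂ : P.starProjection v₂ = Real.cos θ' • w₂ := by
    rw [hc']
    refine starProjection_eq_smul_of_forall_inner_le (w₁ := w₁) hw₂ hw₂n ?_ ?_
    · rw [P.inner_starProjection_left_eq_right, P.starProjection_eq_self_iff.mpr hw₁,
        ← V.starProjection_eq_self_iff.mpr hv₂, V.inner_starProjection_left_eq_right, hVw₁,
        real_inner_smul_right, hv₂₁, mul_zero]
    · exact fun u hu hun hu₁ ↦ hc' ▸ hmax' ⟨v₂, hv₂, u, hu, hv₂n, hun, hv₂₁, hu₁, rfl⟩
  have hVw₂ : V.starProjection w₂ = Real.cos θ' • v₂ := by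
    rw [hc', real_inner_comm]
    refine starProjection_eq_smul_of_forall_inner_le (w₁ := v₁) hv₂ hv₂n ?_ ?_
    · rw [V.inner_starProjection_left_eq_right, V.starProjection_eq_self_iff.mpr hv₁,
        ← P.starProjection_eq_self_iff.mpr hw₂, P.inner_starProjection_left_eq_right, hPv₁,
        real_inner_smul_right, hw₂₁, mul_zero]
    · intro u hu hun hu₁
      rw [real_inner_comm, real_inner_comm v₂, ← hc']
      exact hmax' ⟨u, hu, w₂, hw₂, hun, hw₂n, hu₁, hw₂₁, rfl⟩
  exact ⟨⟨v₁, isPrincipalUnit_iff.mpr ⟨hv₁, hv₁n, by rw [hPv₁, map_smul, hVw₁, smul_smul, sq]⟩⟩,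
    v₂, isPrincipalUnit_iff.mpr ⟨hv₂, hv₂n, by rw [hPv₂, map_smul, hVw₂, smul_smul, sq]⟩⟩

namespace IsPrincipalUnit

theorem mem (h : IsPrincipalUnit V P θ T) : T ∈ V := h.2.1

theorem inner_self (h : IsPrincipalUnit V P θ T) : ⟪T, T⟫ = 1 := by
  rw [real_inner_self_eq_norm_sq, h.1, one_pow]

theorem inner_starProjection (h : IsPrincipalUnit V P θ T) {z : Euc 4} (hz : z ∈ V) :
    ⟪P.starProjection T, z⟫ = Real.cos θ ^ 2 * ⟪T, z⟫ := by
  rw [← real_inner_smul_left, ← (isPrincipalUnit_iff.mp h).2.2,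
    V.inner_starProjection_left_eq_right, V.starProjection_eq_self_iff.mpr hz]

theorem inner_starProjection_starProjection (h : IsPrincipalUnit V P θ T) {z : Euc 4}
    (hz : z ∈ V) : ⟪P.starProjection T, P.starProjection z⟫ = Real.cos θ ^ 2 * ⟪T, z⟫ := by
  rw [← P.inner_starProjection_left_eq_right,
    P.starProjection_eq_self_iff.mpr (P.starProjection_apply_mem T), h.inner_starProjection hz]

theorem inner_eq_zero (h : IsPrincipalUnit V P θ T) (h' : IsPrincipalUnit V P θ' T')
    (hθ : Real.cos θ ^ 2 ≠ Real.cos θ' ^ 2) : ⟪T, T'⟫ = 0 := by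
  have heq := h.inner_starProjection_starProjection h'.mem
  rw [real_inner_comm, h'.inner_starProjection_starProjection h.mem, real_inner_comm] at heq
  exact (mul_eq_mul_right_iff.mp heq).resolve_left hθ.symm

theorem starProjection_sub_smul (h : IsPrincipalUnit V P θ T) (h' : IsPrincipalUnit V P θ' T')
    (hθ : Real.cos θ ^ 2 ≠ Real.cos θ' ^ 2) (hV : Module.finrank ℝ V = 2) {z : Euc 4}
    (hz : z ∈ V) : V.starProjection (P.starProjection z) - Real.cos θ' ^ 2 • z =
      ((Real.cos θ ^ 2 - Real.cos θ' ^ 2) * ⟪T, z⟫) • T := by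
  have hz := inner_smul_add_inner_smul_of_mem hV h.mem h'.mem h.1 h'.1 (h.inner_eq_zero h' hθ) hz
  conv_lhs => rw [← hz]
  simp only [map_add, map_smul, (isPrincipalUnit_iff.mp h).2.2, (isPrincipalUnit_iff.mp h').2.2]
  module

theorem normalize_smul (h : IsPrincipalUnit V P θ T) {c : ℝ} (hc : c ≠ 0) :
    IsPrincipalUnit V P θ (‖c • T‖⁻¹ • c • T) := by
  obtain ⟨hT, hnorm, heigen⟩ := isPrincipalUnit_iff.mp h
  refine isPrincipalUnit_iff.mpr ⟨V.smul_mem _ (V.smul_mem _ hT), ?_, ?_⟩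
  · simp [norm_smul, hnorm, hc]
  · simp only [map_smul, heigen, smul_comm _ (Real.cos θ ^ 2)]

theorem inner_principalNormal (h : IsPrincipalUnit V P θ T) {z : Euc 4} (hz : z ∈ V) :
    ⟪principalNormal P θ T, z⟫ = 0 := by
  rw [principalNormal, real_inner_smul_left, inner_sub_left, real_inner_smul_left,
    real_inner_smul_left, h.inner_starProjection hz]
  rcases eq_or_ne (Real.cos θ) 0 with hc | _
  · simp [hc]
  · field_simp
    ring

theorem inner_principalNormal_principalNormal (h : IsPrincipalUnit V P θ T)
    (h' : IsPrincipalUnit V P θ' T') (hθ : GenericAngles θ θ') :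
    ⟪principalNormal P θ T, principalNormal P θ' T'⟫ = 0 := by
  rw [principalNormal.eq_1 P θ' T', real_inner_smul_right, inner_sub_right, real_inner_smul_right,
    h.inner_principalNormal h'.mem, real_inner_smul_right, principalNormal, real_inner_smul_left,
    inner_sub_left, real_inner_smul_left, real_inner_smul_left, real_inner_comm,
    h'.inner_starProjection h.mem, h.inner_starProjection_starProjection h'.mem,
    real_inner_comm, h.inner_eq_zero h' hθ.cos_sq_ne]
  ring

theorem norm_principalNormal (h : IsPrincipalUnit V P θ T) (hc : Real.cos θ ≠ 0)
    (hs : Real.sin θ ≠ 0) : ‖principalNormal P θ T‖ = 1 := by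
  refine (pow_eq_one_iff_of_nonneg (norm_nonneg _) two_ne_zero).mp ?_
  rw [← real_inner_self_eq_norm_sq, principalNormal.eq_1, real_inner_smul_right, inner_sub_right,
    real_inner_smul_right, ← principalNormal, h.inner_principalNormal h.mem,
    real_inner_smul_right, principalNormal, real_inner_smul_left, inner_sub_left,
    real_inner_smul_left, real_inner_smul_left, real_inner_comm, h.inner_starProjection h.mem,
    h.inner_starProjection_starProjection h.mem, h.inner_self]
  field_simp
  linarith [Real.sin_sq_add_cos_sq θ]

end IsPrincipalUnit

theorem cos_smul_sub_sin_smul_principalNormal_mem (hs : Real.sin θ ≠ 0) (T : Euc 4) :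
    Real.cos θ • T - Real.sin θ • principalNormal P θ T ∈ P := by
  rw [principalNormal, smul_inv_smul₀ hs, sub_sub_cancel]
  exact P.smul_mem _ (P.starProjection_apply_mem T)

theorem sin_smul_add_cos_smul_principalNormal_mem (hc : Real.cos θ ≠ 0) (hs : Real.sin θ ≠ 0)
    (T : Euc 4) :
    Real.sin θ • T + Real.cos θ • principalNormal P θ T ∈ Pᗮ := by
  have heq : Real.sin θ • T + Real.cos θ • principalNormal P θ T =
      (Real.sin θ)⁻¹ • (T - P.starProjection T) := by
    rw [principalNormal, smul_sub, smul_sub, smul_sub, smul_smul, smul_smul, smul_smul, smul_smul]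
    match_scalars
    · field_simp
      linarith [Real.sin_sq_add_cos_sq θ]
    · field_simp
  rw [heq]
  exact Pᗮ.smul_mem _ (P.sub_starProjection_mem_orthogonal T)

end PrincipalUnit

/-! ### Differential calculus -/

section Calculus

variable {E F G : Type*} [NormedAddCommGroup E] [NormedSpace ℝ E] [NormedAddCommGroup F]
  [NormedSpace ℝ F] [NormedAddCommGroup G] [NormedSpace ℝ G]

theorem differentiableAt_of_contDiffAt_infty {f : E → F} {x : E} (h : ContDiffAt ℝ ∞ f x) :
    DifferentiableAt ℝ f x :=
  h.differentiableAt (by simp)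

theorem eventually_differentiableAt {f : E → F} {x : E} (h : ContDiffAt ℝ ∞ f x) :
    ∀ᶠ y in 𝓝 x, DifferentiableAt ℝ f y :=
  ((h.of_le (m := 1) (by simp)).eventually (by simp)).mono fun _ hy ↦ hy.differentiableAt (by simp)

theorem contDiffAt_infty_fderiv {f : E → F} {x : E} (h : ContDiffAt ℝ ∞ f x) :
    ContDiffAt ℝ ∞ (fderiv ℝ f) x :=
  h.fderiv_right le_rfl

theorem fderiv_fderiv_comm {f : E → F} {x : E} (h : ContDiffAt ℝ ∞ f x) (u v : E) :
    fderiv ℝ (fderiv ℝ f) x u v = fderiv ℝ (fderiv ℝ f) x v u :=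
  (h.isSymmSndFDerivAt (by
    rw [minSmoothness_of_isRCLikeNormedField]
    exact WithTop.coe_le_coe.mpr le_top)).eq u v

theorem fderiv_apply_const {A : E → F →L[ℝ] G} {x : E} (hA : DifferentiableAt ℝ A x) (c : F)
    (v : E) : fderiv ℝ (fun y ↦ A y c) x v = fderiv ℝ A x v c := by
  rw [fderiv_clm_apply hA (differentiableAt_const c)]
  simp

theorem fderiv_fderiv_comp_apply {g : E → F} {f : F → G} {x : E} (hf : ContDiffAt ℝ ∞ f (g x))
    (hg : ContDiffAt ℝ ∞ g x) (u v : E) :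
    fderiv ℝ (fderiv ℝ (f ∘ g)) x u v =
      fderiv ℝ (fderiv ℝ f) (g x) (fderiv ℝ g x u) (fderiv ℝ g x v) +
        fderiv ℝ f (g x) (fderiv ℝ (fderiv ℝ g) x u v) := by
  have chain : fderiv ℝ (f ∘ g) =ᶠ[𝓝 x] fun y ↦ (fderiv ℝ f (g y)).comp (fderiv ℝ g y) := by
    filter_upwards [hg.continuousAt.eventually (eventually_differentiableAt hf),
      eventually_differentiableAt hg] with y hfy hgy
    exact fderiv_comp y hfy hgy
  have hdf : HasFDerivAt (fun y ↦ fderiv ℝ f (g y)) _ x :=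
    (differentiableAt_of_contDiffAt_infty (contDiffAt_infty_fderiv hf)).hasFDerivAt.comp x
      (differentiableAt_of_contDiffAt_infty hg).hasFDerivAt
  have hdg := (differentiableAt_of_contDiffAt_infty (contDiffAt_infty_fderiv hg)).hasFDerivAt
  rw [chain.fderiv_eq, (hdf.clm_comp hdg).fderiv, add_comm]
  simp

theorem exists_contDiffOn_primitive [CompleteSpace F] {B : Set E} (hB : Convex ℝ B)
    (hBo : IsOpen B) {η : E → E →L[ℝ] F} (hη : ContDiffOn ℝ ∞ η B)
    (hc : ∀ x ∈ B, ∀ u v, fderiv ℝ η x u v = fderiv ℝ η x v u) :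
    ∃ t : E → F, ContDiffOn ℝ ∞ t B ∧ ∀ x ∈ B, HasFDerivAt t (η x) x := by
  obtain ⟨t, ht⟩ := hB.exists_forall_hasFDerivAt_of_fderiv_symmetric hBo
    (hη.differentiableOn (by simp)) hc
  refine ⟨t, ?_, ht⟩
  rw [contDiffOn_infty_iff_fderiv_of_isOpen hBo]
  exact ⟨fun x hx ↦ (ht x hx).differentiableAt.differentiableWithinAt,
    hη.congr fun x hx ↦ (ht x hx).fderiv⟩

theorem exists_smooth_local_inverse [FiniteDimensional ℝ E] [FiniteDimensional ℝ F]
    (hd : Module.finrank ℝ E = Module.finrank ℝ F) {g : E → F} {B : Set E} (hB : IsOpen B)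
    (hg : ContDiffOn ℝ ∞ g B) (hinj : ∀ x ∈ B, Function.Injective (fderiv ℝ g x)) {x₀ : E}
    (hx₀ : x₀ ∈ B) :
    ∃ K : OpenPartialHomeomorph E F, x₀ ∈ K.source ∧ K.source ⊆ B ∧ (∀ x, K x = g x) ∧
      ContDiffOn ℝ ∞ K.symm K.target := by
  have : CompleteSpace E := FiniteDimensional.complete ℝ E
  have hgat {x} (hx : x ∈ B) : ContDiffAt ℝ ∞ g x := hg.contDiffAt (hB.mem_nhds hx)
  have hequiv {x} (hx : x ∈ B) : ∃ e : E ≃L[ℝ] F, HasFDerivAt g (e : E →L[ℝ] F) x := by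
    refine ⟨(LinearMap.linearEquivOfInjective (fderiv ℝ g x : E →ₗ[ℝ] F)
      (hinj x hx) hd).toContinuousLinearEquiv, ?_⟩
    convert (differentiableAt_of_contDiffAt_infty (hgat hx)).hasFDerivAt
    ext
    rfl
  obtain ⟨e₀, he₀⟩ := hequiv hx₀
  let K := ((hgat hx₀).toOpenPartialHomeomorph g he₀ (by simp)).restrOpen B hB
  have hsource : K.source ⊆ B := Set.inter_subset_right
  refine ⟨K, ⟨(hgat hx₀).mem_toOpenPartialHomeomorph_source he₀ (by simp), hx₀⟩, hsource,
    fun x ↦ rfl, fun y hy ↦ ?_⟩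
  have hyB : K.symm y ∈ B := hsource (K.map_target hy)
  obtain ⟨e, he⟩ := hequiv hyB
  exact (K.contDiffAt_symm hy he (hgat hyB)).contDiffWithinAt

end Calculus

section InnerProductCalculus

variable {E F G : Type*} [NormedAddCommGroup E] [NormedSpace ℝ E] [NormedAddCommGroup F]
  [InnerProductSpace ℝ F] [NormedAddCommGroup G] [InnerProductSpace ℝ G] {A B : E → F} {x : E}

theorem fderiv_innerSL_comp_apply {B : E → G →L[ℝ] F} (hA : DifferentiableAt ℝ A x)
    (hB : DifferentiableAt ℝ B x) (u : E) (v : G) :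
    fderiv ℝ (fun y ↦ (innerSL ℝ (A y)).comp (B y)) x u v =
      ⟪A x, fderiv ℝ B x u v⟫ + ⟪fderiv ℝ A x u, B x v⟫ := by
  have hAB : DifferentiableAt ℝ (fun y ↦ (innerSL ℝ (A y)).comp (B y)) x :=
    ((innerSL ℝ).differentiableAt.comp x hA).clm_comp hB
  rw [← fderiv_apply_const hAB, ← fderiv_apply_const hB,
    ← fderiv_inner_apply ℝ hA (hB.clm_apply (differentiableAt_const v))]
  rfl

theorem inner_fderiv_add_eq_zero {c : ℝ} (hA : DifferentiableAt ℝ A x)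
    (hB : DifferentiableAt ℝ B x) (h : ∀ᶠ y in 𝓝 x, ⟪A y, B y⟫ = c) (v : E) :
    ⟪A x, fderiv ℝ B x v⟫ + ⟪fderiv ℝ A x v, B x⟫ = 0 := by
  rw [← fderiv_inner_apply ℝ hA hB, Filter.EventuallyEq.fderiv_eq (f := fun _ ↦ c) h]
  simp

theorem inner_fderiv_self_eq_zero {c : ℝ} (hA : DifferentiableAt ℝ A x)
    (h : ∀ᶠ y in 𝓝 x, ‖A y‖ = c) (v : E) : ⟪A x, fderiv ℝ A x v⟫ = 0 := by
  have := inner_fderiv_add_eq_zero (c := c ^ 2) hA hA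
    (h.mono fun y hy ↦ by rw [real_inner_self_eq_norm_sq, hy]) v
  rw [real_inner_comm (A x) (fderiv ℝ A x v)] at this
  rw [real_inner_comm] at this ⊢
  linarith

theorem inner_fderiv_eq_zero_of_eventually_mem {W : Submodule ℝ F} (hA : DifferentiableAt ℝ A x)
    (h : ∀ᶠ y in 𝓝 x, A y ∈ W) {z : F} (hz : z ∈ Wᗮ) (v : E) : ⟪fderiv ℝ A x v, z⟫ = 0 := by
  simpa using inner_fderiv_add_eq_zero (c := 0) hA (differentiableAt_const z)
    (h.mono fun y hy ↦ Submodule.inner_right_of_mem_orthogonal hy hz) v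

/-- Both sides are `-⟪D²A(u, v), B⟫`. -/
theorem inner_fderiv_normal_comm (hA : ContDiffAt ℝ ∞ A x) (hB : DifferentiableAt ℝ B x)
    (h : ∀ᶠ y in 𝓝 x, ∀ u, ⟪fderiv ℝ A y u, B y⟫ = 0) (u v : E) :
    ⟪fderiv ℝ A x u, fderiv ℝ B x v⟫ = ⟪fderiv ℝ A x v, fderiv ℝ B x u⟫ := by
  have hd := differentiableAt_of_contDiffAt_infty (contDiffAt_infty_fderiv hA)
  have key (u v : E) :
      ⟪fderiv ℝ A x u, fderiv ℝ B x v⟫ + ⟪fderiv ℝ (fderiv ℝ A) x v u, B x⟫ = 0 := by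
    rw [← fderiv_apply_const hd]
    exact inner_fderiv_add_eq_zero (hd.clm_apply (differentiableAt_const u)) hB
      (h.mono fun y hy ↦ hy u) v
  linarith [key u v, key v u, congrArg (⟪·, B x⟫) (fderiv_fderiv_comm hA u v)]

theorem contDiff_adjoint [CompleteSpace F] [CompleteSpace G] :
    ContDiff ℝ ∞ fun D : F →L[ℝ] G ↦ D.adjoint :=
  IsBoundedLinearMap.contDiff
    { map_add := map_add _
      map_smul := fun c D ↦ by simp
      bound := ⟨1, one_pos, fun D ↦ by simp⟩ }

theorem starProjection_range_eq [CompleteSpace F] [CompleteSpace G] {D : F →L[ℝ] G}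
    [D.range.HasOrthogonalProjection] (hD : (D.adjoint.comp D).IsInvertible) :
    D.range.starProjection = D.comp ((D.adjoint.comp D).inverse.comp D.adjoint) := by
  ext z
  refine Submodule.eq_starProjection_of_mem_of_inner_eq_zero
    (LinearMap.mem_range_self D.toLinearMap ((D.adjoint.comp D).inverse (D.adjoint z))) ?_
  rintro _ ⟨w, rfl⟩
  have hinv : D.adjoint (D ((D.adjoint.comp D).inverse (D.adjoint z))) = D.adjoint z :=
    hD.self_apply_inverse _
  rw [ContinuousLinearMap.coe_coe, ← ContinuousLinearMap.adjoint_inner_left, map_sub,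
    ContinuousLinearMap.comp_apply, ContinuousLinearMap.comp_apply, hinv, sub_self,
    inner_zero_left]

theorem contDiffAt_starProjection_range [FiniteDimensional ℝ F] [CompleteSpace G]
    {D : E → F →L[ℝ] G} (hD : ContDiffAt ℝ ∞ D x)
    (hinj : ∀ᶠ y in 𝓝 x, Function.Injective (D y)) :
    ContDiffAt ℝ ∞ (fun y ↦ (D y).range.starProjection) x := by
  have : CompleteSpace F := FiniteDimensional.complete ℝ F
  have invertible {y : E} (hy : Function.Injective (D y)) :
      ((D y).adjoint.comp (D y)).IsInvertible := by
    have := (D y).adjoint_comp_self_injective_iff.mpr hy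
    exact ⟨(LinearEquiv.ofInjectiveEndo ((D y).adjoint.comp (D y)).toLinearMap
      this).toContinuousLinearEquiv, by ext; rfl⟩
  have hadj : ContDiffAt ℝ ∞ (fun y ↦ (D y).adjoint) x := contDiff_adjoint.contDiffAt.comp x hD
  have hinv : ContDiffAt ℝ ∞ (fun y ↦ ((D y).adjoint.comp (D y)).inverse) x :=
    ContDiffAt.comp (g := ContinuousLinearMap.inverse) x
      (invertible hinj.self_of_nhds).contDiffAt_map_inverse (hadj.clm_comp hD)
  exact (hD.clm_comp (hinv.clm_comp hadj)).congr_of_eventuallyEq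
    (hinj.mono fun y hy ↦ starProjection_range_eq (invertible hy))

theorem eq_zero_or_eq_zero_of_finrank_eq_one {W : Submodule ℝ F} (hW : Module.finrank ℝ W = 1)
    {z w : F} (hz : z ∈ W) (hw : w ∈ W) (h : ⟪z, w⟫ = 0) : z = 0 ∨ w = 0 := by
  by_contra! hne
  obtain ⟨c, hc⟩ := (finrank_eq_one_iff_of_nonzero' (⟨z, hz⟩ : W)
    (fun e ↦ hne.1 (congrArg Subtype.val e))).mp hW ⟨w, hw⟩
  obtain rfl : c • z = w := congrArg Subtype.val hc
  rw [real_inner_smul_right, mul_eq_zero, inner_self_eq_zero] at h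
  exact h.elim (fun hc₀ ↦ hne.2 (by rw [hc₀, zero_smul])) hne.1

end InnerProductCalculus

/-! ### Isometric immersions of Euclidean domains -/

namespace IsIsometricImmersionOn

variable {m n : ℕ} {f : Euc m → Euc n} {U : Set (Euc m)} {x : Euc m}

theorem contDiffAt (h : IsIsometricImmersionOn f U) (hx : x ∈ U) : ContDiffAt ℝ ∞ f x :=
  h.2.1.contDiffAt (h.1.mem_nhds hx)

theorem mono (h : IsIsometricImmersionOn f U) {U' : Set (Euc m)} (hU' : IsOpen U')
    (hsub : U' ⊆ U) : IsIsometricImmersionOn f U' :=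
  ⟨hU', h.2.1.mono hsub, fun x hx ↦ h.2.2 x (hsub hx)⟩

theorem injective_fderiv (h : IsIsometricImmersionOn f U) (hx : x ∈ U) :
    Function.Injective (fderiv ℝ f x) := by
  refine (injective_iff_map_eq_zero _).mpr fun u hu ↦ ?_
  rw [← inner_self_eq_zero (𝕜 := ℝ), ← h.2.2 x hx, hu, inner_zero_left]

/-- Koszul's argument: an expression in `u, v, w` that is symmetric in `u, v` and antisymmetric in
`v, w` vanishes. -/
theorem inner_fderiv_fderiv (h : IsIsometricImmersionOn f U) (hx : x ∈ U) (u v w : Euc m) :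
    ⟪fderiv ℝ (fderiv ℝ f) x u v, fderiv ℝ f x w⟫ = 0 := by
  have hf := h.contDiffAt hx
  have hd := differentiableAt_of_contDiffAt_infty (contDiffAt_infty_fderiv hf)
  have antisymm (u v w : Euc m) : ⟪fderiv ℝ f x v, fderiv ℝ (fderiv ℝ f) x u w⟫ +
      ⟪fderiv ℝ (fderiv ℝ f) x u v, fderiv ℝ f x w⟫ = 0 := by
    rw [← fderiv_apply_const hd, ← fderiv_apply_const hd]
    exact inner_fderiv_add_eq_zero (hd.clm_apply (differentiableAt_const v))
      (hd.clm_apply (differentiableAt_const w))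
      ((h.1.eventually_mem hx).mono fun y hy ↦ h.2.2 y hy v w) u
  have h₁ := antisymm u v w
  have h₂ := antisymm v w u
  have h₃ := antisymm w u v
  rw [real_inner_comm] at h₁ h₂ h₃
  rw [fderiv_fderiv_comm hf v u] at h₂
  rw [fderiv_fderiv_comm hf w u, fderiv_fderiv_comm hf w v] at h₃
  linarith

theorem fderiv_fderiv_mem_orthogonal (h : IsIsometricImmersionOn f U) (hx : x ∈ U)
    (u v : Euc m) : fderiv ℝ (fderiv ℝ f) x u v ∈ (fderiv ℝ f x).rangeᗮ := by
  rw [Submodule.mem_orthogonal']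
  rintro _ ⟨w, rfl⟩
  exact h.inner_fderiv_fderiv hx u v w

/-- The Gauss equation. -/
theorem inner_fderiv_fderiv_comm (h : IsIsometricImmersionOn f U) (hx : x ∈ U)
    (u v w z : Euc m) :
    ⟪fderiv ℝ (fderiv ℝ f) x u v, fderiv ℝ (fderiv ℝ f) x w z⟫ =
      ⟪fderiv ℝ (fderiv ℝ f) x u w, fderiv ℝ (fderiv ℝ f) x v z⟫ := by
  have hdf := contDiffAt_infty_fderiv (h.contDiffAt hx)
  have hd := differentiableAt_of_contDiffAt_infty hdf
  have hdd := differentiableAt_of_contDiffAt_infty (contDiffAt_infty_fderiv hdf)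
  have hddu (a b : Euc m) := (hdd.clm_apply (differentiableAt_const a)).clm_apply
    (differentiableAt_const b)
  have third (a b c : Euc m) : fderiv ℝ (fun y ↦ fderiv ℝ (fderiv ℝ f) y b c) x a =
      fderiv ℝ (fderiv ℝ (fderiv ℝ f)) x a b c := by
    rw [fderiv_apply_const (hdd.clm_apply (differentiableAt_const b)), fderiv_apply_const hdd]
  have leibniz (v w : Euc m) :
      ⟪fderiv ℝ (fderiv ℝ f) x u v, fderiv ℝ (fderiv ℝ f) x w z⟫ +
        ⟪fderiv ℝ (fderiv ℝ (fderiv ℝ f)) x w u v, fderiv ℝ f x z⟫ = 0 := by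
    rw [← third, ← fderiv_apply_const hd z w]
    exact inner_fderiv_add_eq_zero (hddu u v) (hd.clm_apply (differentiableAt_const z))
      ((h.1.eventually_mem hx).mono fun y hy ↦ h.inner_fderiv_fderiv hy u v z) w
  have last_comm : fderiv ℝ (fderiv ℝ (fderiv ℝ f)) x u w v =
      fderiv ℝ (fderiv ℝ (fderiv ℝ f)) x u v w := by
    have hsymm : (fderiv ℝ (fderiv ℝ f) · w v) =ᶠ[𝓝 x] (fderiv ℝ (fderiv ℝ f) · v w) :=
      (h.1.eventually_mem hx).mono fun y hy ↦ fderiv_fderiv_comm (h.contDiffAt hy) w v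
    rw [← third, hsymm.fderiv_eq, third]
  have third_comm : fderiv ℝ (fderiv ℝ (fderiv ℝ f)) x w u v =
      fderiv ℝ (fderiv ℝ (fderiv ℝ f)) x v u w := by
    rw [fderiv_fderiv_comm hdf, last_comm, fderiv_fderiv_comm hdf]
  linarith [leibniz v w, leibniz w v, congrArg (⟪·, fderiv ℝ f x z⟫) third_comm]

theorem finrank_orthogonal_range_fderiv {f : Euc m → Euc (m + 1)}
    (h : IsIsometricImmersionOn f U) (hx : x ∈ U) :
    Module.finrank ℝ (fderiv ℝ f x).rangeᗮ = 1 := by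
  have := (fderiv ℝ f x).range.finrank_add_finrank_orthogonal
  rw [LinearMap.finrank_range_of_inj (h.injective_fderiv hx), finrank_euclideanSpace_fin,
    finrank_euclideanSpace_fin] at this
  omega

end IsIsometricImmersionOn

theorem exists_isIsometricImmersionOn_comp_symm {E : Type*} [NormedAddCommGroup E]
    [NormedSpace ℝ E] [FiniteDimensional ℝ E] {m n : ℕ} (hd : Module.finrank ℝ E = m)
    {f : E → Euc n} {g : E → Euc m} {B : Set E} (hB : IsOpen B) (hf : ContDiffOn ℝ ∞ f B)
    (hg : ContDiffOn ℝ ∞ g B) (hinj : ∀ x ∈ B, Function.Injective (fderiv ℝ f x))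
    (hmetric : ∀ x ∈ B, ∀ u v, ⟪fderiv ℝ g x u, fderiv ℝ g x v⟫ = ⟪fderiv ℝ f x u, fderiv ℝ f x v⟫)
    {x₀ : E} (hx₀ : x₀ ∈ B) :
    ∃ K : OpenPartialHomeomorph E (Euc m), x₀ ∈ K.source ∧ K.source ⊆ B ∧ (∀ x, K x = g x) ∧
      ContDiffOn ℝ ∞ K.symm K.target ∧ IsIsometricImmersionOn (f ∘ K.symm) K.target := by
  have hginj (x : E) (hx : x ∈ B) : Function.Injective (fderiv ℝ g x) := by
    refine (injective_iff_map_eq_zero _).mpr fun u hu ↦ ?_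
    have := hmetric x hx u u
    rw [hu, inner_zero_left, eq_comm, inner_self_eq_zero] at this
    exact (injective_iff_map_eq_zero _).mp (hinj x hx) u this
  obtain ⟨K, hx₀K, hKB, hKg, hK⟩ := exists_smooth_local_inverse
    (by rw [hd, finrank_euclideanSpace_fin]) hB hg hginj hx₀
  have hmaps : Set.MapsTo K.symm K.target B := fun y hy ↦ hKB (K.map_target hy)
  refine ⟨K, hx₀K, hKB, hKg, hK, K.open_target, hf.comp hK hmaps, fun y hy u v ↦ ?_⟩
  have hKy := differentiableAt_of_contDiffAt_infty (hK.contDiffAt (K.open_target.mem_nhds hy))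
  have diff {k : ℕ} {a : E → Euc k} (ha : ContDiffOn ℝ ∞ a B) : DifferentiableAt ℝ a (K.symm y) :=
    differentiableAt_of_contDiffAt_infty (ha.contDiffAt (hB.mem_nhds (hmaps hy)))
  have inverse (w : Euc m) : fderiv ℝ g (K.symm y) (fderiv ℝ K.symm y w) = w := by
    have hid : g ∘ K.symm =ᶠ[𝓝 y] id := (K.open_target.eventually_mem hy).mono fun z hz ↦
      (hKg _).symm.trans (K.right_inv hz)
    rw [← ContinuousLinearMap.comp_apply, ← fderiv_comp y (diff hg) hKy, hid.fderiv_eq, fderiv_id,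
      ContinuousLinearMap.id_apply]
  rw [fderiv_comp y (diff hf) hKy, ContinuousLinearMap.comp_apply, ContinuousLinearMap.comp_apply,
    ← hmetric _ (hmaps hy), inverse, inverse]

theorem IsCompositionOn.mono {f : Euc 2 → Euc 4} {U U' : Set (Euc 2)} (h : IsCompositionOn f U)
    (hU' : IsOpen U') (hsub : U' ⊆ U) : IsCompositionOn f U' := by
  obtain ⟨hf, g, W, F, hg, hF, hmaps, heq⟩ := h
  exact ⟨hf.mono hU' hsub, g, W, F, hg.mono hU' hsub, hF, hmaps.mono_left hsub, heq.mono hsub⟩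

/-! ### Principal frames and their structure equations -/

/-- Smooth unit fields `T`, `T'` of principal vectors for the angles `θ`, `θ'` along an immersion
`f` of an open set `U` of the plane. -/
structure PrincipalFrame (f : Euc 2 → Euc 4) (U : Set (Euc 2)) (P : Submodule ℝ (Euc 4))
    (θ θ' : ℝ) where
  T : Euc 2 → Euc 4
  T' : Euc 2 → Euc 4
  generic : GenericAngles θ θ'
  isOpen : IsOpen U
  contDiffOn : ContDiffOn ℝ ∞ f U
  injective_fderiv : ∀ x ∈ U, Function.Injective (fderiv ℝ f x)
  contDiffOn_T : ContDiffOn ℝ ∞ T U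
  contDiffOn_T' : ContDiffOn ℝ ∞ T' U
  isPrincipalUnit : ∀ x ∈ U, IsPrincipalUnit (fderiv ℝ f x).range P θ (T x)
  isPrincipalUnit' : ∀ x ∈ U, IsPrincipalUnit (fderiv ℝ f x).range P θ' (T' x)

/-- The coefficient of `κ τ` in the connection form of a principal frame. -/
def angleCoeff (θ θ' : ℝ) : ℝ :=
  Real.cos θ' * Real.sin θ' / (Real.cos θ ^ 2 - Real.cos θ' ^ 2)

theorem GenericAngles.angleCoeff_ne_zero {θ θ' : ℝ} (h : GenericAngles θ θ') :
    angleCoeff θ θ' ≠ 0 :=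
  div_ne_zero (mul_ne_zero h.cos_ne_zero' h.sin_ne_zero') (sub_ne_zero.mpr h.cos_sq_ne)

theorem GenericAngles.angleCoeff_mul {θ θ' : ℝ} (h : GenericAngles θ θ') :
    angleCoeff θ θ' * (Real.cos θ ^ 2 - Real.cos θ' ^ 2) = Real.cos θ' * Real.sin θ' :=
  div_mul_cancel₀ _ (sub_ne_zero.mpr h.cos_sq_ne)

namespace PrincipalFrame

variable {f : Euc 2 → Euc 4} {U : Set (Euc 2)} {P : Submodule ℝ (Euc 4)} {θ θ' : ℝ}
  (A : PrincipalFrame f U P θ θ')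

/-- The same frame with the roles of the two principal directions exchanged. The objects attached
to the second direction are those attached to the first one of the exchanged frame. -/
def swap : PrincipalFrame f U P θ' θ where
  T := A.T'
  T' := A.T
  generic := A.generic.swap
  isOpen := A.isOpen
  contDiffOn := A.contDiffOn
  injective_fderiv := A.injective_fderiv
  contDiffOn_T := A.contDiffOn_T'
  contDiffOn_T' := A.contDiffOn_T
  isPrincipalUnit := A.isPrincipalUnit'
  isPrincipalUnit' := A.isPrincipalUnit

theorem swap_T : A.swap.T = A.T' := rfl

theorem swap_T' : A.swap.T' = A.T := rfl

theorem swap_swap : A.swap.swap = A := rfl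

/-- The unit normal field in the plane of `T` and its projection to `P`. -/
def N (x : Euc 2) : Euc 4 :=
  principalNormal P θ (A.T x)

/-- The form `τ = ⟪T, df⟫` of the coframe dual to `T`, `T'`. -/
def coframe (x : Euc 2) : Euc 2 →L[ℝ] ℝ :=
  (innerSL ℝ (A.T x)).comp (fderiv ℝ f x)

/-- The connection form `ω = ⟪T, dT'⟫`. -/
def connForm (x : Euc 2) : Euc 2 →L[ℝ] ℝ :=
  (innerSL ℝ (A.T x)).comp (fderiv ℝ A.T' x)

/-- The vector of the parameter plane that `df` takes to `T`; meaningful on `U` only. -/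
def vec (x : Euc 2) : Euc 2 :=
  Function.invFun (fderiv ℝ f x) (A.T x)

/-- The normal curvature `κ` of the direction `T`: its second fundamental form is `κ` times the
unit normal vector associated with the other direction `T'`. -/
def curvature (x : Euc 2) : ℝ :=
  ⟪A.swap.N x, fderiv ℝ A.T x (A.vec x)⟫

theorem coframe_apply (x v : Euc 2) : A.coframe x v = ⟪A.T x, fderiv ℝ f x v⟫ := rfl

theorem connForm_apply (x v : Euc 2) : A.connForm x v = ⟪A.T x, fderiv ℝ A.T' x v⟫ := rfl

theorem contDiffOn_N : ContDiffOn ℝ ∞ A.N U := by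
  have := A.contDiffOn_T
  unfold N principalNormal
  fun_prop

variable {x : Euc 2} (hx : x ∈ U)
include A hx

theorem contDiffAt : ContDiffAt ℝ ∞ f x :=
  A.contDiffOn.contDiffAt (A.isOpen.mem_nhds hx)

theorem contDiffAt_T : ContDiffAt ℝ ∞ A.T x :=
  A.contDiffOn_T.contDiffAt (A.isOpen.mem_nhds hx)

theorem contDiffAt_N : ContDiffAt ℝ ∞ A.N x :=
  A.contDiffOn_N.contDiffAt (A.isOpen.mem_nhds hx)

theorem differentiableAt_T : DifferentiableAt ℝ A.T x :=
  differentiableAt_of_contDiffAt_infty (A.contDiffAt_T hx)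

theorem differentiableAt_N : DifferentiableAt ℝ A.N x :=
  differentiableAt_of_contDiffAt_infty (A.contDiffAt_N hx)

theorem norm_T : ‖A.T x‖ = 1 := (A.isPrincipalUnit x hx).1

theorem norm_N : ‖A.N x‖ = 1 :=
  (A.isPrincipalUnit x hx).norm_principalNormal A.generic.cos_ne_zero A.generic.sin_ne_zero

theorem inner_T_T' : ⟪A.T x, A.T' x⟫ = 0 :=
  (A.isPrincipalUnit x hx).inner_eq_zero (A.isPrincipalUnit' x hx) A.generic.cos_sq_ne

theorem inner_N_N' : ⟪A.N x, A.swap.N x⟫ = 0 :=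
  (A.isPrincipalUnit x hx).inner_principalNormal_principalNormal (A.isPrincipalUnit' x hx) A.generic

theorem inner_fderiv_N (v : Euc 2) : ⟪fderiv ℝ f x v, A.N x⟫ = 0 := by
  rw [real_inner_comm]
  exact (A.isPrincipalUnit x hx).inner_principalNormal ⟨v, rfl⟩

theorem inner_T_N : ⟪A.T x, A.N x⟫ = 0 := by
  rw [real_inner_comm]
  exact (A.isPrincipalUnit x hx).inner_principalNormal (A.isPrincipalUnit x hx).mem

theorem inner_T'_N : ⟪A.T' x, A.N x⟫ = 0 := by
  rw [real_inner_comm]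
  exact (A.isPrincipalUnit x hx).inner_principalNormal (A.isPrincipalUnit' x hx).mem

theorem sum_inner_smul (z : Euc 4) : ⟪A.T x, z⟫ • A.T x + ⟪A.T' x, z⟫ • A.T' x +
    ⟪A.N x, z⟫ • A.N x + ⟪A.swap.N x, z⟫ • A.swap.N x = z := by
  have horth : Orthonormal ℝ ![A.T x, A.T' x, A.N x, A.swap.N x] := by
    simp only [orthonormal_vecCons_iff, Fin.forall_fin_succ, Matrix.cons_val_zero,
      Matrix.cons_val_succ, IsEmpty.forall_iff, and_true]
    exact ⟨A.norm_T hx, ⟨A.inner_T_T' hx, A.inner_T_N hx, A.swap.inner_T'_N hx⟩, A.swap.norm_T hx,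
      ⟨A.inner_T'_N hx, A.swap.inner_T_N hx⟩, A.norm_N hx, A.inner_N_N' hx, A.swap.norm_N hx,
      trivial, Orthonormal.of_isEmpty _⟩
  simpa [Fin.sum_univ_four] using sum_inner_smul_of_mem horth (W := ⊤) (fun _ ↦ trivial)
    (by simp) (z := z) trivial

theorem finrank_range_fderiv : Module.finrank ℝ (fderiv ℝ f x).range = 2 := by
  rw [LinearMap.finrank_range_of_inj (A.injective_fderiv x hx), finrank_euclideanSpace_fin]

theorem fderiv_apply (v : Euc 2) :
    fderiv ℝ f x v = A.coframe x v • A.T x + A.swap.coframe x v • A.T' x :=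
  (inner_smul_add_inner_smul_of_mem (A.finrank_range_fderiv hx) (A.isPrincipalUnit x hx).mem
    (A.isPrincipalUnit' x hx).mem (A.norm_T hx) (A.swap.norm_T hx) (A.inner_T_T' hx)
    ⟨v, rfl⟩).symm

theorem fderiv_apply_vec : fderiv ℝ f x (A.vec x) = A.T x :=
  Function.invFun_eq (A.isPrincipalUnit x hx).mem

theorem coframe_vec : A.coframe x (A.vec x) = 1 := by
  rw [coframe_apply, A.fderiv_apply_vec hx, (A.isPrincipalUnit x hx).inner_self]

theorem swap_coframe_vec : A.swap.coframe x (A.vec x) = 0 := by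
  rw [coframe_apply, A.fderiv_apply_vec hx]
  exact A.swap.inner_T_T' hx

theorem coframe_swap_vec : A.coframe x (A.swap.vec x) = 0 :=
  A.swap.swap_coframe_vec hx

theorem inner_T_fderiv_T (v : Euc 2) : ⟪A.T x, fderiv ℝ A.T x v⟫ = 0 :=
  inner_fderiv_self_eq_zero (A.differentiableAt_T hx)
    ((A.isOpen.eventually_mem hx).mono fun _ ↦ A.norm_T) v

theorem inner_N_fderiv_N (v : Euc 2) : ⟪A.N x, fderiv ℝ A.N x v⟫ = 0 :=
  inner_fderiv_self_eq_zero (A.differentiableAt_N hx)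
    ((A.isOpen.eventually_mem hx).mono fun _ ↦ A.norm_N) v

theorem inner_T_fderiv_N (v : Euc 2) : ⟪A.T x, fderiv ℝ A.N x v⟫ = -⟪A.N x, fderiv ℝ A.T x v⟫ := by
  rw [eq_neg_iff_add_eq_zero, real_inner_comm _ (A.N x)]
  exact inner_fderiv_add_eq_zero (A.differentiableAt_T hx) (A.differentiableAt_N hx)
    ((A.isOpen.eventually_mem hx).mono fun _ ↦ A.inner_T_N) v

theorem inner_T'_fderiv_N (v : Euc 2) :
    ⟪A.T' x, fderiv ℝ A.N x v⟫ = -⟪A.N x, fderiv ℝ A.T' x v⟫ := by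
  rw [eq_neg_iff_add_eq_zero, real_inner_comm _ (A.N x)]
  exact inner_fderiv_add_eq_zero (A.swap.differentiableAt_T hx) (A.differentiableAt_N hx)
    ((A.isOpen.eventually_mem hx).mono fun _ ↦ A.inner_T'_N) v

theorem swap_connForm (v : Euc 2) : A.swap.connForm x v = -A.connForm x v := by
  rw [connForm_apply, connForm_apply, eq_neg_iff_add_eq_zero, real_inner_comm _ (A.T x)]
  exact inner_fderiv_add_eq_zero (A.swap.differentiableAt_T hx) (A.differentiableAt_T hx)
    ((A.isOpen.eventually_mem hx).mono fun _ ↦ A.swap.inner_T_T') v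

theorem inner_swap_N_fderiv_N (v : Euc 2) :
    ⟪A.swap.N x, fderiv ℝ A.N x v⟫ = -⟪A.N x, fderiv ℝ A.swap.N x v⟫ := by
  rw [eq_neg_iff_add_eq_zero, real_inner_comm _ (A.N x)]
  exact inner_fderiv_add_eq_zero (A.swap.differentiableAt_N hx) (A.differentiableAt_N hx)
    ((A.isOpen.eventually_mem hx).mono fun _ ↦ A.swap.inner_N_N') v

/-- `cos θ • T - sin θ • N` takes its values in the fixed subspace `P`. -/
theorem cos_mul_inner_fderiv_T {z : Euc 4} (hz : z ∈ Pᗮ) (v : Euc 2) :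
    Real.cos θ * ⟪z, fderiv ℝ A.T x v⟫ = Real.sin θ * ⟪z, fderiv ℝ A.N x v⟫ := by
  have hT := (A.differentiableAt_T hx).const_smul (Real.cos θ)
  have hN := (A.differentiableAt_N hx).const_smul (Real.sin θ)
  have := inner_fderiv_eq_zero_of_eventually_mem (hT.sub hN) (.of_forall fun y ↦
    cos_smul_sub_sin_smul_principalNormal_mem A.generic.sin_ne_zero (A.T y)) hz v
  rw [fderiv_sub hT hN, fderiv_const_smul (A.differentiableAt_T hx),
    fderiv_const_smul (A.differentiableAt_N hx), real_inner_comm] at this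
  simpa [inner_sub_right, real_inner_smul_right, sub_eq_zero] using this

theorem inner_N_fderiv_T (v : Euc 2) : ⟪A.N x, fderiv ℝ A.T x v⟫ = 0 := by
  have := A.cos_mul_inner_fderiv_T hx (sin_smul_add_cos_smul_principalNormal_mem
    A.generic.cos_ne_zero A.generic.sin_ne_zero (A.T x)) v
  change _ * ⟪_ + _ • A.N x, _⟫ = _ * ⟪_ + _ • A.N x, _⟫ at this
  simp only [inner_add_left, real_inner_smul_left, A.inner_T_fderiv_T hx, A.inner_N_fderiv_N hx,
    A.inner_T_fderiv_N hx] at this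
  linear_combination this - ⟪A.N x, fderiv ℝ A.T x v⟫ * Real.sin_sq_add_cos_sq θ

theorem inner_swap_N_fderiv_T (v : Euc 2) :
    ⟪A.swap.N x, fderiv ℝ A.T x v⟫ = A.curvature x * A.coframe x v := by
  have inner_fderiv (u v : Euc 2) : ⟪fderiv ℝ f x u, fderiv ℝ A.swap.N x v⟫ =
      -(A.coframe x u * ⟪A.swap.N x, fderiv ℝ A.T x v⟫) := by
    rw [A.fderiv_apply hx, inner_add_left, real_inner_smul_left, real_inner_smul_left]
    have hT := A.swap.inner_T'_fderiv_N hx v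
    have hT' := A.swap.inner_T_fderiv_N hx v
    rw [swap_T'] at hT
    rw [A.swap.inner_N_fderiv_T hx, neg_zero, swap_T] at hT'
    rw [hT, hT']
    ring
  have := inner_fderiv_normal_comm (A.contDiffAt hx) (A.swap.differentiableAt_N hx)
    ((A.isOpen.eventually_mem hx).mono fun _ hy ↦ A.swap.inner_fderiv_N hy) v (A.vec x)
  rw [inner_fderiv, inner_fderiv, A.coframe_vec hx] at this
  rw [curvature]
  linarith

/-- The relation obtained by differentiating the vector `cos θ • T - sin θ • N` of `P` and pairing
with the vector `sin θ' • T' + cos θ' • N'` of `Pᗮ`. -/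
theorem angle_relation (v : Euc 2) :
    Real.cos θ * (Real.cos θ' * (A.curvature x * A.coframe x v) - Real.sin θ' * A.connForm x v) =
      -Real.sin θ * (Real.sin θ' * (A.swap.curvature x * A.swap.coframe x v) +
        Real.cos θ' * ⟪A.N x, fderiv ℝ A.swap.N x v⟫) := by
  have := A.cos_mul_inner_fderiv_T hx (sin_smul_add_cos_smul_principalNormal_mem
    A.generic.cos_ne_zero' A.generic.sin_ne_zero' (A.T' x)) v
  change _ * ⟪_ + _ • A.swap.N x, _⟫ = _ * ⟪_ + _ • A.swap.N x, _⟫ at this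
  simp only [inner_add_left, real_inner_smul_left, A.inner_T'_fderiv_N hx,
    A.inner_swap_N_fderiv_T hx, A.inner_swap_N_fderiv_N hx] at this
  have hω := A.swap_connForm hx v
  have hσ := A.swap.inner_swap_N_fderiv_T hx v
  rw [connForm_apply, swap_T, swap_T'] at hω
  rw [swap_swap, swap_T] at hσ
  rw [hω, hσ] at this
  linear_combination this

theorem connForm_eq (v : Euc 2) : A.connForm x v =
    angleCoeff θ θ' * (A.curvature x * A.coframe x v) -
      angleCoeff θ' θ * (A.swap.curvature x * A.swap.coframe x v) := by
  have h := A.angle_relation hx v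
  have h' := A.swap.angle_relation hx v
  rw [A.swap_connForm hx, swap_swap, A.inner_swap_N_fderiv_N hx] at h'
  apply mul_right_cancel₀ (sub_ne_zero.mpr A.generic.cos_sq_ne)
  linear_combination
    (-Real.sin θ' * Real.cos θ) * h - (Real.sin θ * Real.cos θ') * h'
      - (A.curvature x * A.coframe x v) * A.generic.angleCoeff_mul
      - (A.swap.curvature x * A.swap.coframe x v) * A.generic.swap.angleCoeff_mul
      + (Real.cos θ' * Real.sin θ' * (A.curvature x * A.coframe x v)
        + Real.cos θ' ^ 2 * A.connForm x v) * Real.sin_sq_add_cos_sq θ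
      + (Real.cos θ * Real.sin θ * (A.swap.curvature x * A.swap.coframe x v)
        - Real.cos θ ^ 2 * A.connForm x v) * Real.sin_sq_add_cos_sq θ'

theorem connForm_vec : A.connForm x (A.vec x) = angleCoeff θ θ' * A.curvature x := by
  rw [A.connForm_eq hx, A.coframe_vec hx, A.swap_coframe_vec hx]
  ring

theorem inner_N_fderiv_swap_N (v : Euc 2) : ⟪A.N x, fderiv ℝ A.swap.N x v⟫ =
    angleCoeff θ θ' * (A.swap.curvature x * A.swap.coframe x v) -
      angleCoeff θ' θ * (A.curvature x * A.coframe x v) := by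
  have h := A.angle_relation hx v
  have h' := A.swap.angle_relation hx v
  rw [A.swap_connForm hx, swap_swap, A.inner_swap_N_fderiv_N hx] at h'
  apply mul_right_cancel₀ (sub_ne_zero.mpr A.generic.cos_sq_ne)
  linear_combination
    (-Real.sin θ * Real.cos θ') * h - (Real.sin θ' * Real.cos θ) * h'
      - (A.swap.curvature x * A.swap.coframe x v) * A.generic.angleCoeff_mul
      - (A.curvature x * A.coframe x v) * A.generic.swap.angleCoeff_mul
      + (Real.cos θ' * Real.sin θ' * (A.swap.curvature x * A.swap.coframe x v)
        + Real.cos θ' ^ 2 * ⟪A.N x, fderiv ℝ A.swap.N x v⟫) * Real.sin_sq_add_cos_sq θ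
      + (Real.cos θ * Real.sin θ * (A.curvature x * A.coframe x v)
        - Real.cos θ ^ 2 * ⟪A.N x, fderiv ℝ A.swap.N x v⟫) * Real.sin_sq_add_cos_sq θ'

theorem fderiv_T (v : Euc 2) : fderiv ℝ A.T x v =
    -A.connForm x v • A.T' x + (A.curvature x * A.coframe x v) • A.swap.N x := by
  have h := A.sum_inner_smul hx (fderiv ℝ A.T x v)
  have hω := A.swap_connForm hx v
  rw [connForm_apply, swap_T, swap_T'] at hω
  rw [hω, A.inner_T_fderiv_T hx, A.inner_N_fderiv_T hx, A.inner_swap_N_fderiv_T hx] at h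
  simpa using h.symm

theorem fderiv_swap_N (v : Euc 2) : fderiv ℝ A.swap.N x v =
    -(A.curvature x * A.coframe x v) • A.T x + ⟪A.N x, fderiv ℝ A.swap.N x v⟫ • A.N x := by
  have h := A.sum_inner_smul hx (fderiv ℝ A.swap.N x v)
  have hT := A.swap.inner_T'_fderiv_N hx v
  have hT' := A.swap.inner_T_fderiv_N hx v
  rw [swap_T', A.inner_swap_N_fderiv_T hx] at hT
  rw [A.swap.inner_N_fderiv_T hx, swap_T] at hT'
  rw [hT, hT', A.swap.inner_N_fderiv_N hx] at h
  simpa using h.symm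

theorem starProjection_orthogonal (z : Euc 4) : (fderiv ℝ f x).rangeᗮ.starProjection z =
    ⟪A.N x, z⟫ • A.N x + ⟪A.swap.N x, z⟫ • A.swap.N x := by
  have normal_mem {n : Euc 4} (hn : ∀ v, ⟪fderiv ℝ f x v, n⟫ = 0) : n ∈ (fderiv ℝ f x).rangeᗮ := by
    rintro _ ⟨v, rfl⟩
    exact hn v
  have htangent : z - (⟪A.N x, z⟫ • A.N x + ⟪A.swap.N x, z⟫ • A.swap.N x) =
      ⟪A.T x, z⟫ • A.T x + ⟪A.T' x, z⟫ • A.T' x := by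
    rw [sub_eq_iff_eq_add, ← add_assoc, A.sum_inner_smul hx]
  refine Submodule.eq_starProjection_of_mem_orthogonal
    (add_mem (Submodule.smul_mem _ _ (normal_mem (A.inner_fderiv_N hx)))
      (Submodule.smul_mem _ _ (normal_mem (A.swap.inner_fderiv_N hx))))
    (Submodule.le_orthogonal_orthogonal _ ?_)
  rw [htangent]
  exact add_mem (Submodule.smul_mem _ _ (A.isPrincipalUnit x hx).mem)
    (Submodule.smul_mem _ _ (A.isPrincipalUnit' x hx).mem)

variable {Z : Euc 2 → Euc 4} (hZ : DifferentiableAt ℝ Z x)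
  (hmem : ∀ᶠ y in 𝓝 x, Z y ∈ (fderiv ℝ f y).range)
include hZ hmem

theorem inner_swap_N_fderiv_of_mem_range (u : Euc 2) :
    ⟪A.swap.N x, fderiv ℝ Z x u⟫ = A.coframe x u * ⟪A.T x, Z x⟫ * A.curvature x := by
  have h := inner_fderiv_add_eq_zero (c := 0) (A.swap.differentiableAt_N hx) hZ (by
    filter_upwards [hmem, A.isOpen.eventually_mem hx] with y hy hyU
    exact (A.isPrincipalUnit' y hyU).inner_principalNormal hy) u
  rw [A.fderiv_swap_N hx, inner_add_left, real_inner_smul_left, real_inner_smul_left,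
    show ⟪A.N x, Z x⟫ = 0 from
      (A.isPrincipalUnit x hx).inner_principalNormal hmem.self_of_nhds] at h
  linear_combination h

theorem starProjection_orthogonal_fderiv_of_mem_range (u : Euc 2) :
    (fderiv ℝ f x).rangeᗮ.starProjection (fderiv ℝ Z x u) =
      (A.coframe x u * ⟪A.T x, Z x⟫) • A.curvature x • A.swap.N x +
        (A.swap.coframe x u * ⟪A.T' x, Z x⟫) • A.swap.curvature x • A.N x := by
  have h := A.swap.inner_swap_N_fderiv_of_mem_range hx hZ hmem u
  rw [swap_swap, swap_T] at h
  rw [A.starProjection_orthogonal hx, A.inner_swap_N_fderiv_of_mem_range hx hZ hmem, h, smul_smul,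
    smul_smul, add_comm]

end PrincipalFrame

/-! ### Curvatures of a principal frame, and compositions -/

namespace PrincipalFrame

variable {f : Euc 2 → Euc 4} {U : Set (Euc 2)} {P : Submodule ℝ (Euc 4)} {θ θ' : ℝ}
  (A : PrincipalFrame f U P θ θ') {x : Euc 2} (hx : x ∈ U)
include hx

theorem inner_fderiv_fderiv_swap_N (u v : Euc 2) :
    ⟪fderiv ℝ (fderiv ℝ f) x u v, A.swap.N x⟫ =
      A.curvature x * (A.coframe x u * A.coframe x v) := by
  have hd := differentiableAt_of_contDiffAt_infty (contDiffAt_infty_fderiv (A.contDiffAt hx))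
  have h := inner_fderiv_add_eq_zero (hd.clm_apply (differentiableAt_const v))
    (A.swap.differentiableAt_N hx)
    ((A.isOpen.eventually_mem hx).mono fun y hy ↦ A.swap.inner_fderiv_N hy v) u
  rw [fderiv_apply_const hd, A.fderiv_swap_N hx, inner_add_right, real_inner_smul_right,
    real_inner_smul_right, A.inner_fderiv_N hx, real_inner_comm, ← coframe_apply] at h
  linarith

theorem fderiv_fderiv_apply (hf : IsIsometricImmersionOn f U) (u v : Euc 2) :
    fderiv ℝ (fderiv ℝ f) x u v =
      (A.swap.curvature x * (A.swap.coframe x u * A.swap.coframe x v)) • A.N x +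
        (A.curvature x * (A.coframe x u * A.coframe x v)) • A.swap.N x := by
  have h := A.sum_inner_smul hx (fderiv ℝ (fderiv ℝ f) x u v)
  have hT := hf.inner_fderiv_fderiv hx u v (A.vec x)
  have hT' := hf.inner_fderiv_fderiv hx u v (A.swap.vec x)
  have hN := A.swap.inner_fderiv_fderiv_swap_N hx u v
  have hN' := A.inner_fderiv_fderiv_swap_N hx u v
  rw [A.fderiv_apply_vec hx, real_inner_comm] at hT
  rw [A.swap.fderiv_apply_vec hx, real_inner_comm, swap_T] at hT'
  rw [swap_swap, real_inner_comm] at hN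
  rw [real_inner_comm] at hN'
  rw [hT, hT', hN, hN'] at h
  simpa using h.symm

theorem eventually_curvature_ne_zero (h : A.curvature x ≠ 0) :
    ∀ᶠ y in 𝓝 x, A.curvature y ≠ 0 := by
  let b (y : Euc 2) : ℝ := ⟪fderiv ℝ (fderiv ℝ f) y (A.vec x) (A.vec x), A.swap.N y⟫
  have hb : ContinuousAt b x :=
    (((contDiffAt_infty_fderiv (contDiffAt_infty_fderiv (A.contDiffAt hx))).continuousAt.clm_apply
      continuousAt_const).clm_apply continuousAt_const).inner
        (A.swap.contDiffAt_N hx).continuousAt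
  have hbx : b x ≠ 0 := by
    simpa [b, A.inner_fderiv_fderiv_swap_N hx, A.coframe_vec hx] using h
  filter_upwards [hb.eventually_ne hbx, A.isOpen.mem_nhds hx] with y hy hyU hκ
  exact hy (by simp only [b, A.inner_fderiv_fderiv_swap_N hyU, hκ, zero_mul])

end PrincipalFrame

/-- The isometric immersion `f` of `U ⊆ ℝ²` is the composition of the isometric immersions
`g : U → W ⊆ ℝ³` and `F : W → ℝ⁴`. -/
structure IsFactorization (f : Euc 2 → Euc 4) (U : Set (Euc 2)) (g : Euc 2 → Euc 3)
    (W : Set (Euc 3)) (F : Euc 3 → Euc 4) : Prop where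
  isometric : IsIsometricImmersionOn f U
  isometric_left : IsIsometricImmersionOn F W
  isometric_right : IsIsometricImmersionOn g U
  mapsTo : Set.MapsTo g U W
  eqOn : Set.EqOn f (F ∘ g) U

namespace IsFactorization

variable {f : Euc 2 → Euc 4} {U : Set (Euc 2)} {g : Euc 2 → Euc 3} {W : Set (Euc 3)}
  {F : Euc 3 → Euc 4} (h : IsFactorization f U g W F) {P : Submodule ℝ (Euc 4)} {θ θ' : ℝ}
  (A : PrincipalFrame f U P θ θ') {x : Euc 2} (hx : x ∈ U)
include h hx

theorem fderiv_fderiv_apply (u v : Euc 2) :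
    fderiv ℝ (fderiv ℝ f) x u v =
      fderiv ℝ (fderiv ℝ F) (g x) (fderiv ℝ g x u) (fderiv ℝ g x v) +
        fderiv ℝ F (g x) (fderiv ℝ (fderiv ℝ g) x u v) := by
  rw [(h.eqOn.eventuallyEq_of_mem (h.isometric.1.mem_nhds hx)).fderiv.fderiv_eq]
  exact fderiv_fderiv_comp_apply (h.isometric_left.contDiffAt (h.mapsTo hx))
    (h.isometric_right.contDiffAt hx) u v

theorem inner_fderiv_fderiv_right (u v : Euc 2) (z : Euc 3) :
    ⟪fderiv ℝ (fderiv ℝ g) x u v, z⟫ = ⟪fderiv ℝ (fderiv ℝ f) x u v, fderiv ℝ F (g x) z⟫ := by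
  rw [h.fderiv_fderiv_apply hx, inner_add_left,
    h.isometric_left.inner_fderiv_fderiv (h.mapsTo hx), h.isometric_left.2.2 _ (h.mapsTo hx),
    zero_add]

theorem fderiv_fderiv_right_vec_swap_vec :
    fderiv ℝ (fderiv ℝ g) x (A.vec x) (A.swap.vec x) = 0 := by
  refine ext_inner_right ℝ fun z ↦ ?_
  rw [h.inner_fderiv_fderiv_right hx, A.fderiv_fderiv_apply hx h.isometric,
    A.swap_coframe_vec hx, A.coframe_swap_vec hx]
  simp

theorem inner_fderiv_fderiv_right_vec (z : Euc 3) :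
    ⟪fderiv ℝ (fderiv ℝ g) x (A.vec x) (A.vec x), z⟫ =
      A.curvature x * ⟪fderiv ℝ F (g x) z, A.swap.N x⟫ := by
  rw [h.inner_fderiv_fderiv_right hx, A.fderiv_fderiv_apply hx h.isometric,
    A.swap_coframe_vec hx, A.coframe_vec hx, real_inner_comm]
  simp [real_inner_smul_right]

/-- Where both curvatures are nonzero, one of the two principal normals is normal to `F`: by the
Gauss equation for `g`, the second fundamental form of `g` vanishes on one principal vector. -/
theorem inner_fderiv_left_eq_zero_or (hκ : A.curvature x ≠ 0) (hκ' : A.swap.curvature x ≠ 0) :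
    (∀ z, ⟪fderiv ℝ F (g x) z, A.swap.N x⟫ = 0) ∨ ∀ z, ⟪fderiv ℝ F (g x) z, A.N x⟫ = 0 := by
  have gauss := h.isometric_right.inner_fderiv_fderiv_comm hx (A.vec x) (A.vec x) (A.swap.vec x)
    (A.swap.vec x)
  rw [h.fderiv_fderiv_right_vec_swap_vec A hx, inner_zero_left] at gauss
  refine (eq_zero_or_eq_zero_of_finrank_eq_one
    (h.isometric_right.finrank_orthogonal_range_fderiv hx)
    (h.isometric_right.fderiv_fderiv_mem_orthogonal hx _ _)
    (h.isometric_right.fderiv_fderiv_mem_orthogonal hx _ _) gauss).imp (fun h₀ z ↦ ?_)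
    fun h₀ z ↦ ?_
  · have := h.inner_fderiv_fderiv_right_vec A hx z
    rw [h₀, inner_zero_left, zero_eq_mul] at this
    exact this.resolve_left hκ
  · have := h.inner_fderiv_fderiv_right_vec A.swap hx z
    rw [h₀, inner_zero_left, zero_eq_mul] at this
    exact this.resolve_left hκ'

theorem exists_inner_fderiv_left_ne_zero (hN : ∀ z, ⟪fderiv ℝ F (g x) z, A.swap.N x⟫ = 0) :
    ∃ z, ⟪fderiv ℝ F (g x) z, A.N x⟫ ≠ 0 := by
  by_contra! hN'
  have mem {n : Euc 4} (hn : ∀ z, ⟪fderiv ℝ F (g x) z, n⟫ = 0) : n ∈ (fderiv ℝ F (g x)).rangeᗮ := by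
    rw [Submodule.mem_orthogonal]
    rintro _ ⟨z, rfl⟩
    exact hn z
  rcases eq_zero_or_eq_zero_of_finrank_eq_one
    (h.isometric_left.finrank_orthogonal_range_fderiv (h.mapsTo hx)) (mem hN') (mem hN)
    (A.inner_N_N' hx) with h₀ | h₀
  · simpa [h₀] using A.norm_N hx
  · simpa [h₀] using A.swap.norm_N hx

theorem eventually_inner_fderiv_left_eq_zero (hκ : A.curvature x ≠ 0)
    (hκ' : A.swap.curvature x ≠ 0) (hN : ∀ z, ⟪fderiv ℝ F (g x) z, A.swap.N x⟫ = 0) :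
    ∀ᶠ y in 𝓝 x, ∀ z, ⟪fderiv ℝ F (g y) z, A.swap.N y⟫ = 0 := by
  obtain ⟨z, hz⟩ := h.exists_inner_fderiv_left_ne_zero A hx hN
  have hF := contDiffAt_infty_fderiv (h.isometric_left.contDiffAt (h.mapsTo hx))
  have hc : ContinuousAt (fun y ↦ ⟪fderiv ℝ F (g y) z, A.N y⟫) x :=
    ((hF.continuousAt.comp (h.isometric_right.contDiffAt hx).continuousAt).clm_apply
      continuousAt_const).inner (A.contDiffAt_N hx).continuousAt
  filter_upwards [A.isOpen.mem_nhds hx, hc.eventually_ne hz, A.eventually_curvature_ne_zero hx hκ,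
    A.swap.eventually_curvature_ne_zero hx hκ'] with y hy hzy hκy hκy'
  exact (h.inner_fderiv_left_eq_zero_or A hy hκy hκy').resolve_right fun h₀ ↦ hzy (h₀ z)

/-- By the Gauss equation for `F`, whose second fundamental form is `κ N'` on `T, T` and vanishes on
`T, T'`. -/
theorem inner_fderiv_fderiv_left_swap_vec (hκ : A.curvature x ≠ 0)
    (hN : ∀ z, ⟪fderiv ℝ F (g x) z, A.swap.N x⟫ = 0) (z : Euc 3) :
    ⟪fderiv ℝ (fderiv ℝ F) (g x) (fderiv ℝ g x (A.swap.vec x)) z, A.swap.N x⟫ = 0 := by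
  have mixed : fderiv ℝ (fderiv ℝ F) (g x) (fderiv ℝ g x (A.swap.vec x)) (fderiv ℝ g x (A.vec x)) =
      0 := by
    have := h.fderiv_fderiv_apply hx (A.swap.vec x) (A.vec x)
    rw [A.fderiv_fderiv_apply hx h.isometric, A.swap_coframe_vec hx,
      A.coframe_swap_vec hx, fderiv_fderiv_comm (h.isometric_right.contDiffAt hx),
      h.fderiv_fderiv_right_vec_swap_vec A hx] at this
    simpa using this.symm
  have pure : fderiv ℝ (fderiv ℝ F) (g x) (fderiv ℝ g x (A.vec x)) (fderiv ℝ g x (A.vec x)) =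
      A.curvature x • A.swap.N x := by
    have hg : fderiv ℝ (fderiv ℝ g) x (A.vec x) (A.vec x) = 0 :=
      ext_inner_right ℝ fun z ↦ by
        rw [h.inner_fderiv_fderiv_right_vec A hx, hN, mul_zero, inner_zero_left]
    have := h.fderiv_fderiv_apply hx (A.vec x) (A.vec x)
    rw [A.fderiv_fderiv_apply hx h.isometric, A.swap_coframe_vec hx, A.coframe_vec hx, hg] at this
    simpa using this.symm
  have gauss := h.isometric_left.inner_fderiv_fderiv_comm (h.mapsTo hx)
    (fderiv ℝ g x (A.swap.vec x)) z (fderiv ℝ g x (A.vec x)) (fderiv ℝ g x (A.vec x))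
  rw [mixed, pure, inner_zero_left, real_inner_smul_right] at gauss
  exact (mul_eq_zero.mp gauss).resolve_left hκ

/-- If `N'` stays normal to `F`, its derivative along `T'` is normal to `F` as well, but that
derivative is a nonzero multiple of `N`. -/
theorem false_of_inner_fderiv_left_eq_zero (hκ : A.curvature x ≠ 0)
    (hκ' : A.swap.curvature x ≠ 0) (hN : ∀ z, ⟪fderiv ℝ F (g x) z, A.swap.N x⟫ = 0) : False := by
  obtain ⟨z, hz⟩ := h.exists_inner_fderiv_left_ne_zero A hx hN
  have hdF := differentiableAt_of_contDiffAt_infty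
    (contDiffAt_infty_fderiv (h.isometric_left.contDiffAt (h.mapsTo hx)))
  have hdg := differentiableAt_of_contDiffAt_infty (h.isometric_right.contDiffAt hx)
  have hdFg : DifferentiableAt ℝ (fun y ↦ fderiv ℝ F (g y)) x := hdF.comp x hdg
  have hsecond : fderiv ℝ (fun y ↦ fderiv ℝ F (g y) z) x (A.swap.vec x) =
      fderiv ℝ (fderiv ℝ F) (g x) (fderiv ℝ g x (A.swap.vec x)) z := by
    rw [fderiv_apply_const hdFg]
    exact congrArg (· (A.swap.vec x) z) (fderiv_comp x hdF hdg)
  have key := inner_fderiv_add_eq_zero (hdFg.clm_apply (differentiableAt_const z))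
    (A.swap.differentiableAt_N hx)
    ((h.eventually_inner_fderiv_left_eq_zero A hx hκ hκ' hN).mono fun y hy ↦ hy z) (A.swap.vec x)
  rw [hsecond, h.inner_fderiv_fderiv_left_swap_vec A hx hκ hN, A.fderiv_swap_N hx,
    A.inner_N_fderiv_swap_N hx, A.swap.coframe_vec hx, A.coframe_swap_vec hx] at key
  simp [real_inner_smul_right, A.generic.angleCoeff_ne_zero, hκ', hz] at key

theorem curvature_eq_zero_or : A.curvature x = 0 ∨ A.swap.curvature x = 0 := by
  by_contra! hκ
  rcases h.inner_fderiv_left_eq_zero_or A hx hκ.1 hκ.2 with hN | hN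
  · exact h.false_of_inner_fderiv_left_eq_zero A hx hκ.1 hκ.2 hN
  · exact h.false_of_inner_fderiv_left_eq_zero A.swap hx hκ.2 hκ.1 hN

end IsFactorization

/-! ### Flat coordinates -/

namespace PrincipalFrame

variable {f : Euc 2 → Euc 4} {U : Set (Euc 2)} {P : Submodule ℝ (Euc 4)} {θ θ' : ℝ}
  (A : PrincipalFrame f U P θ θ')

theorem contDiffOn_coframe : ContDiffOn ℝ ∞ A.coframe U := fun _ hx ↦
  (((innerSL ℝ).contDiff.contDiffAt.comp _ (A.contDiffAt_T hx)).clm_comp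
    (contDiffAt_infty_fderiv (A.contDiffAt hx))).contDiffWithinAt

theorem contDiffOn_connForm : ContDiffOn ℝ ∞ A.connForm U := fun _ hx ↦
  (((innerSL ℝ).contDiff.contDiffAt.comp _ (A.contDiffAt_T hx)).clm_comp
    (contDiffAt_infty_fderiv (A.swap.contDiffAt_T hx))).contDiffWithinAt

/-- The complex-valued coframe `τ + iτ'`. -/
def complexCoframe (x : Euc 2) : Euc 2 →L[ℝ] ℂ :=
  (A.coframe x).smulRight 1 + (A.swap.coframe x).smulRight Complex.I

theorem inner_complexCoframe (x u v : Euc 2) : ⟪A.complexCoframe x u, A.complexCoframe x v⟫ =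
    A.coframe x u * A.coframe x v + A.swap.coframe x u * A.swap.coframe x v := by
  simp [Complex.inner, complexCoframe, mul_comm]

section Pointwise

variable {x : Euc 2} (hx : x ∈ U)
include hx

theorem fderiv_coframe_apply (u v : Euc 2) : fderiv ℝ A.coframe x u v =
    ⟪A.T x, fderiv ℝ (fderiv ℝ f) x u v⟫ - A.connForm x u * A.swap.coframe x v := by
  unfold coframe
  rw [fderiv_innerSL_comp_apply (A.differentiableAt_T hx)
    (differentiableAt_of_contDiffAt_infty (contDiffAt_infty_fderiv (A.contDiffAt hx))),
    A.fderiv_T hx, inner_add_left, real_inner_smul_left, real_inner_smul_left,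
    real_inner_comm _ (A.swap.N x), A.swap.inner_fderiv_N hx, ← swap_T]
  simp only [ContinuousLinearMap.comp_apply, innerSL_apply_apply]
  ring

theorem inner_fderiv_fderiv (u v : Euc 2) : ⟪fderiv ℝ f x u, fderiv ℝ f x v⟫ =
    A.coframe x u * A.coframe x v + A.swap.coframe x u * A.swap.coframe x v := by
  rw [A.fderiv_apply hx u, inner_add_left, real_inner_smul_left, real_inner_smul_left]
  rfl

theorem fderiv_connForm_comm (hκ : A.curvature x = 0) (u v : Euc 2) :
    fderiv ℝ A.connForm x u v = fderiv ℝ A.connForm x v u := by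
  have hT' : ContDiffAt ℝ ∞ A.T' x := A.swap.contDiffAt_T hx
  have key (u v : Euc 2) : fderiv ℝ A.connForm x u v = ⟪A.T x, fderiv ℝ (fderiv ℝ A.T') x u v⟫ := by
    have hself : ⟪A.T' x, fderiv ℝ A.T' x v⟫ = 0 := A.swap.inner_T_fderiv_T hx v
    unfold connForm
    rw [fderiv_innerSL_comp_apply (A.differentiableAt_T hx)
      (differentiableAt_of_contDiffAt_infty (contDiffAt_infty_fderiv hT')), A.fderiv_T hx, hκ,
      zero_mul, zero_smul, add_zero, real_inner_smul_left, hself, mul_zero, add_zero]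
  rw [key, key, fderiv_fderiv_comm hT']

theorem fderiv_complexCoframe_apply (u v : Euc 2) : fderiv ℝ A.complexCoframe x u v =
    ⟪A.T x, fderiv ℝ (fderiv ℝ f) x u v⟫ + ⟪A.T' x, fderiv ℝ (fderiv ℝ f) x u v⟫ * Complex.I +
      Complex.I * A.connForm x u * A.complexCoframe x v := by
  have hτ := differentiableAt_of_contDiffAt_infty
    (A.contDiffOn_coframe.contDiffAt (A.isOpen.mem_nhds hx))
  have hτ' := differentiableAt_of_contDiffAt_infty
    (A.swap.contDiffOn_coframe.contDiffAt (A.isOpen.mem_nhds hx))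
  have hsmul {τ : Euc 2 → Euc 2 →L[ℝ] ℝ} (h : DifferentiableAt ℝ τ x) (c : ℂ) :
      HasFDerivAt (fun y ↦ (τ y).smulRight c) _ x :=
    ((ContinuousLinearMap.smulRightL ℝ (Euc 2) ℂ).flip c).hasFDerivAt.comp x h.hasFDerivAt
  have hζ : HasFDerivAt A.complexCoframe _ x := (hsmul hτ 1).add (hsmul hτ' Complex.I)
  rw [hζ.fderiv]
  simp only [complexCoframe, add_apply, ContinuousLinearMap.comp_apply,
    ContinuousLinearMap.flip_apply, ContinuousLinearMap.smulRightL_apply_apply,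
    ContinuousLinearMap.smulRight_apply, A.fderiv_coframe_apply hx,
    A.swap.fderiv_coframe_apply hx, A.swap_connForm hx, swap_T, swap_swap, Complex.real_smul,
    Complex.ofReal_sub, Complex.ofReal_mul, Complex.ofReal_add, mul_one, neg_mul, sub_neg_eq_add]
  linear_combination (-(A.connForm x u : ℂ) * A.swap.coframe x v) * Complex.I_mul_I

end Pointwise

/-- The form `τ + iτ'` is turned at the rate `ω`, so that it becomes closed when it is multiplied by
`exp (it)` for a primitive `t` of `-ω`. -/
theorem exists_flat_coordinates (hκ : ∀ x ∈ U, A.curvature x = 0) {B : Set (Euc 2)}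
    (hB : Convex ℝ B) (hBo : IsOpen B) (hBU : B ⊆ U) :
    ∃ Ψ : Euc 2 → ℂ, ContDiffOn ℝ ∞ Ψ B ∧
      ∀ x ∈ B, ∀ u v, ⟪fderiv ℝ Ψ x u, fderiv ℝ Ψ x v⟫ = ⟪fderiv ℝ f x u, fderiv ℝ f x v⟫ := by
  obtain ⟨t, ht, hdt⟩ := exists_contDiffOn_primitive hB hBo (A.contDiffOn_connForm.neg.mono hBU)
    fun x hx u v ↦ by
      simp [fderiv_fun_neg, A.fderiv_connForm_comm (hBU hx) (hκ x (hBU hx)) u v]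
  have hζ : ContDiffOn ℝ ∞ A.complexCoframe B := by
    have := A.contDiffOn_coframe.mono hBU
    have := A.swap.contDiffOn_coframe.mono hBU
    unfold complexCoframe
    fun_prop
  have hexp : ContDiffOn ℝ ∞ (fun x ↦ Complex.exp (t x * Complex.I)) B := by
    have : ContDiffOn ℝ ∞ (fun x ↦ (t x : ℂ)) B := Complex.ofRealCLM.contDiff.comp_contDiffOn ht
    fun_prop
  obtain ⟨Ψ, hΨ, hdΨ⟩ := exists_contDiffOn_primitive hB hBo
    (η := fun x ↦ Complex.exp (t x * Complex.I) • A.complexCoframe x) (hexp.smul hζ)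
    fun x hx u v ↦ by
    have ht' : HasFDerivAt (fun x ↦ Complex.exp (t x * Complex.I)) _ x :=
      ((Complex.ofRealCLM.hasFDerivAt.comp x (hdt x hx)).mul_const Complex.I).cexp
    have hζ' := (differentiableAt_of_contDiffAt_infty (hζ.contDiffAt (hBo.mem_nhds hx))).hasFDerivAt
    have hη : HasFDerivAt (fun x ↦ Complex.exp (t x * Complex.I) • A.complexCoframe x) _ x :=
      ht'.smul hζ'
    rw [hη.fderiv]
    simp only [Function.comp_apply, Complex.ofRealCLM_apply, add_apply, smul_apply, neg_apply,
      smul_neg, neg_smul, ContinuousLinearMap.comp_neg, ContinuousLinearMap.comp_apply,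
      ContinuousLinearMap.smulRight_apply, smul_eq_mul, A.fderiv_complexCoframe_apply (hBU hx),
      fderiv_fderiv_comm (A.contDiffAt (hBU hx)) u v]
    ring
  refine ⟨Ψ, hΨ, fun x hx u v ↦ ?_⟩
  rw [(hdΨ x hx).fderiv, A.inner_fderiv_fderiv (hBU hx), ← A.inner_complexCoframe]
  exact (rotation (Circle.exp (t x))).inner_map_map _ _

theorem exists_isometric_reparametrization (hκ : ∀ x ∈ U, A.curvature x = 0) {x₀ : Euc 2}
    (hx₀ : x₀ ∈ U) : ∃ (ψ : Euc 2 → Euc 2) (O : Set (Euc 2)), ContDiffOn ℝ ∞ ψ O ∧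
      Set.MapsTo ψ O U ∧ x₀ ∈ ψ '' O ∧ IsIsometricImmersionOn (f ∘ ψ) O := by
  obtain ⟨r, hr, hrU⟩ := Metric.isOpen_iff.mp A.isOpen x₀ hx₀
  obtain ⟨Ψ, hΨ, hmetric⟩ := A.exists_flat_coordinates hκ (convex_ball x₀ r) Metric.isOpen_ball hrU
  let L := Complex.orthonormalBasisOneI.repr
  have hdL (x u : Euc 2) : fderiv ℝ (L ∘ Ψ) x u = L (fderiv ℝ Ψ x u) := by
    rw [L.comp_fderiv]
    rfl
  obtain ⟨K, hx₀K, hKB, -, hK, hiso⟩ := exists_isIsometricImmersionOn_comp_symm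
    finrank_euclideanSpace_fin Metric.isOpen_ball (A.contDiffOn.mono hrU)
    (L.contDiff.comp_contDiffOn hΨ) (fun x hx ↦ A.injective_fderiv x (hrU hx))
    (fun x hx u v ↦ by rw [hdL, hdL, L.inner_map_map, hmetric x hx])
    (Metric.mem_ball_self hr)
  exact ⟨K.symm, K.target, hK, fun y hy ↦ hrU (hKB (K.map_target hy)),
    ⟨K x₀, K.map_source hx₀K, K.left_inv hx₀K⟩, hiso⟩

end PrincipalFrame

/-! ### Ruled extensions -/

/-- The linear map `(u, s) ↦ (u, s)` from `ℝ² × ℝ`, whose product norm is not Euclidean, to `ℝ³`. -/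
def euclideanProd : Euc 2 × ℝ →L[ℝ] Euc 3 :=
  LinearMap.toContinuousLinearMap
    { toFun := fun p ↦ !₂[p.1 0, p.1 1, p.2]
      map_add' := fun p q ↦ by ext k; fin_cases k <;> rfl
      map_smul' := fun c p ↦ by ext k; fin_cases k <;> rfl }

theorem inner_euclideanProd (p q : Euc 2 × ℝ) :
    ⟪euclideanProd p, euclideanProd q⟫ = ⟪p.1, q.1⟫ + p.2 * q.2 := by
  simp [euclideanProd, PiLp.inner_apply, Fin.sum_univ_succ, add_assoc, mul_comm]

theorem isIsometricImmersionOn_euclideanProd {O : Set (Euc 2)} (hO : IsOpen O) :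
    IsIsometricImmersionOn (fun x ↦ euclideanProd (x, 0)) O := by
  let J : Euc 2 →L[ℝ] Euc 3 := euclideanProd.comp (ContinuousLinearMap.inl ℝ (Euc 2) ℝ)
  refine ⟨hO, J.contDiff.contDiffOn, fun x _ u v ↦ ?_⟩
  change ⟪fderiv ℝ J x u, fderiv ℝ J x v⟫ = ⟪u, v⟫
  simp [J, inner_euclideanProd]

namespace PrincipalFrame

variable {f : Euc 2 → Euc 4} {U : Set (Euc 2)} {P : Submodule ℝ (Euc 4)} {θ θ' : ℝ}
  (A : PrincipalFrame f U P θ θ')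

/-- The hypersurface ruled by the lines through `f` in the direction `N' - a T'`; the coefficient
`a` makes the derivative of this direction tangent to `f` where `κ = 0`. -/
def ruledExtension (p : Euc 2 × ℝ) : Euc 4 :=
  f p.1 + p.2 • (A.swap.N p.1 - angleCoeff θ θ' • A.T' p.1)

/-- The flat model of the ruled extension, in which the tangent planes of `f` are all laid out in
the plane `ℝ² × {0}`. -/
def ruledModel (p : Euc 2 × ℝ) : Euc 3 :=
  euclideanProd (p.1 - (angleCoeff θ θ' * p.2) • A.swap.vec p.1, p.2)

/-- The horizontal part of the derivative at `p` in the direction `q` of both the ruled extension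
and its flat model. -/
def displacement (p q : Euc 2 × ℝ) : Euc 2 :=
  q.1 - (angleCoeff θ θ' * q.2) • A.swap.vec p.1 -
    (angleCoeff θ θ' * p.2 * A.connForm p.1 q.1) • A.vec p.1

theorem inner_vec (hf : IsIsometricImmersionOn f U) {x : Euc 2} (hx : x ∈ U) (u : Euc 2) :
    ⟪A.vec x, u⟫ = A.coframe x u := by
  rw [← hf.2.2 x hx, A.fderiv_apply_vec hx, coframe_apply]

theorem contDiffOn_vec (hf : IsIsometricImmersionOn f U) : ContDiffOn ℝ ∞ A.vec U := by
  refine ContDiffOn.congr (f := fun x ↦ (fderiv ℝ f x).adjoint (A.T x)) (fun x hx ↦ ?_) fun x hx ↦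
    ext_inner_right ℝ fun u ↦ ?_
  · have hadjoint := contDiff_adjoint.contDiffAt.comp x (contDiffAt_infty_fderiv (A.contDiffAt hx))
    exact (hadjoint.clm_apply (A.contDiffAt_T hx)).contDiffWithinAt
  · rw [A.inner_vec hf hx, ContinuousLinearMap.adjoint_inner_left, coframe_apply]

theorem differentiableAt_vec (hf : IsIsometricImmersionOn f U) {x : Euc 2} (hx : x ∈ U) :
    DifferentiableAt ℝ A.vec x :=
  differentiableAt_of_contDiffAt_infty ((A.contDiffOn_vec hf).contDiffAt (A.isOpen.mem_nhds hx))

theorem fderiv_vec (hf : IsIsometricImmersionOn f U) {x : Euc 2} (hx : x ∈ U) (u : Euc 2) :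
    fderiv ℝ A.vec x u = -A.connForm x u • A.swap.vec x := by
  refine ext_inner_right ℝ fun v ↦ ?_
  have hcoframe : A.coframe =ᶠ[𝓝 x] fun y ↦ innerSL ℝ (A.vec y) :=
    (A.isOpen.eventually_mem hx).mono fun y hy ↦ by
      ext v
      rw [innerSL_apply_apply, A.inner_vec hf hy]
  have hderiv : HasFDerivAt (fun y ↦ innerSL ℝ (A.vec y)) _ x :=
    (innerSL ℝ).hasFDerivAt.comp x (A.differentiableAt_vec hf hx).hasFDerivAt
  have h := A.fderiv_coframe_apply hx u v
  rw [hcoframe.fderiv_eq, hderiv.fderiv, ← A.fderiv_apply_vec hx, real_inner_comm,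
    hf.inner_fderiv_fderiv hx, zero_sub] at h
  rw [real_inner_smul_left, A.swap.inner_vec hf hx, neg_mul]
  exact h

theorem fderiv_ruledModel (hf : IsIsometricImmersionOn f U) {p : Euc 2 × ℝ} (hp : p.1 ∈ U)
    (q : Euc 2 × ℝ) : fderiv ℝ A.ruledModel p q = euclideanProd (A.displacement p q, q.2) := by
  have hvec : HasFDerivAt (fun p : Euc 2 × ℝ ↦ A.swap.vec p.1) _ p :=
    (A.swap.differentiableAt_vec hf hp).hasFDerivAt.comp p hasFDerivAt_fst
  have hmodel : HasFDerivAt A.ruledModel _ p := euclideanProd.hasFDerivAt.comp p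
    ((hasFDerivAt_fst.sub ((hasFDerivAt_snd.const_mul (angleCoeff θ θ')).smul hvec)).prodMk
      hasFDerivAt_snd)
  rw [hmodel.fderiv]
  simp only [displacement, add_apply, sub_apply, smul_apply, smul_eq_mul, smul_smul, neg_neg,
    ContinuousLinearMap.comp_apply, ContinuousLinearMap.prod_apply,
    ContinuousLinearMap.smulRight_apply, ContinuousLinearMap.coe_fst',
    ContinuousLinearMap.coe_snd', A.swap.fderiv_vec hf hp, A.swap_connForm hp, swap_swap]
  congr 2
  module

theorem fderiv_ruledExtension {p : Euc 2 × ℝ} (hp : p.1 ∈ U) (hκ : A.curvature p.1 = 0)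
    (q : Euc 2 × ℝ) : fderiv ℝ A.ruledExtension p q =
      fderiv ℝ f p.1 (A.displacement p q) + q.2 • A.swap.N p.1 := by
  have hf : HasFDerivAt (fun p : Euc 2 × ℝ ↦ f p.1) _ p :=
    (differentiableAt_of_contDiffAt_infty (A.contDiffAt hp)).hasFDerivAt.comp p hasFDerivAt_fst
  have hN : HasFDerivAt (fun p : Euc 2 × ℝ ↦ A.swap.N p.1) _ p :=
    (A.swap.differentiableAt_N hp).hasFDerivAt.comp p hasFDerivAt_fst
  have hT : HasFDerivAt (fun p : Euc 2 × ℝ ↦ A.T' p.1) _ p :=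
    (A.swap.differentiableAt_T hp).hasFDerivAt.comp p hasFDerivAt_fst
  have hext : HasFDerivAt A.ruledExtension _ p :=
    hf.add (hasFDerivAt_snd.smul (hN.sub (hT.const_smul (angleCoeff θ θ'))))
  have hdT := A.swap.fderiv_T hp q.1
  have hdN := A.fderiv_swap_N hp q.1
  rw [swap_T, swap_T', swap_swap, A.swap_connForm hp] at hdT
  rw [A.inner_N_fderiv_swap_N hp, hκ] at hdN
  rw [hext.fderiv]
  simp only [displacement, Pi.sub_apply, Pi.smul_apply, add_apply, sub_apply, smul_apply, map_sub,
    map_smul, smul_add, ContinuousLinearMap.comp_apply, ContinuousLinearMap.smulRight_apply,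
    ContinuousLinearMap.coe_fst', ContinuousLinearMap.coe_snd', hdN, hdT, A.fderiv_apply_vec hp,
    A.swap.fderiv_apply_vec hp, swap_T, zero_mul, mul_zero, neg_zero, neg_neg, zero_smul, sub_zero,
    zero_add]
  module

theorem injective_fderiv_ruledExtension {p : Euc 2 × ℝ} (hp : p.1 ∈ U) (hκ : A.curvature p.1 = 0) :
    Function.Injective (fderiv ℝ A.ruledExtension p) := by
  refine (injective_iff_map_eq_zero _).mpr fun q hq ↦ ?_
  rw [A.fderiv_ruledExtension hp hκ] at hq
  have hr : q.2 = 0 := by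
    have := congrArg (⟪·, A.swap.N p.1⟫) hq
    simpa [inner_add_left, real_inner_smul_left, A.swap.inner_fderiv_N hp, A.swap.norm_N hp]
      using this
  rw [hr, zero_smul, add_zero] at hq
  have hu := (injective_iff_map_eq_zero _).mp (A.injective_fderiv _ hp) _ hq
  simp only [displacement, hr, mul_zero, zero_smul, sub_zero, sub_eq_zero] at hu
  have hω := congrArg (A.connForm p.1) hu
  rw [map_smul, A.connForm_vec hp, hκ, mul_zero, smul_zero] at hω
  rw [hω, mul_zero, zero_smul] at hu
  exact Prod.ext hu hr

theorem inner_fderiv_ruledModel (hf : IsIsometricImmersionOn f U) {p : Euc 2 × ℝ} (hp : p.1 ∈ U)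
    (hκ : A.curvature p.1 = 0) (q r : Euc 2 × ℝ) :
    ⟪fderiv ℝ A.ruledModel p q, fderiv ℝ A.ruledModel p r⟫ =
      ⟪fderiv ℝ A.ruledExtension p q, fderiv ℝ A.ruledExtension p r⟫ := by
  rw [A.fderiv_ruledModel hf hp, A.fderiv_ruledModel hf hp, A.fderiv_ruledExtension hp hκ,
    A.fderiv_ruledExtension hp hκ, inner_euclideanProd]
  have hN (v : Euc 2) : ⟪A.swap.N p.1, fderiv ℝ f p.1 v⟫ = 0 :=
    (real_inner_comm _ _).trans (A.swap.inner_fderiv_N hp v)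
  simp only [inner_add_left, inner_add_right, real_inner_smul_left, real_inner_smul_right,
    hf.2.2 p.1 hp, A.swap.inner_fderiv_N hp, hN,
    (real_inner_self_eq_norm_sq _).trans (congrArg (· ^ 2) (A.swap.norm_N hp))]
  ring

theorem contDiffOn_ruledModel (hf : IsIsometricImmersionOn f U) :
    ContDiffOn ℝ ∞ A.ruledModel (U ×ˢ Set.univ) := by
  have : ContDiffOn ℝ ∞ (fun p : Euc 2 × ℝ ↦ A.swap.vec p.1) (U ×ˢ Set.univ) :=
    (A.swap.contDiffOn_vec hf).comp contDiffOn_fst fun p hp ↦ hp.1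
  unfold ruledModel
  fun_prop

theorem contDiffOn_ruledExtension : ContDiffOn ℝ ∞ A.ruledExtension (U ×ˢ Set.univ) := by
  have hfst {b : Euc 2 → Euc 4} (hb : ContDiffOn ℝ ∞ b U) :
      ContDiffOn ℝ ∞ (fun p : Euc 2 × ℝ ↦ b p.1) (U ×ˢ Set.univ) :=
    hb.comp contDiffOn_fst fun p hp ↦ hp.1
  exact (hfst A.contDiffOn).add (contDiffOn_snd.smul
    ((hfst A.swap.contDiffOn_N).sub ((hfst A.contDiffOn_T').const_smul (angleCoeff θ θ'))))

theorem exists_isCompositionOn (hf : IsIsometricImmersionOn f U) (hκ : ∀ x ∈ U, A.curvature x = 0)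
    {x₀ : Euc 2} (hx₀ : x₀ ∈ U) : ∃ O ⊆ U, x₀ ∈ O ∧ IsCompositionOn f O := by
  obtain ⟨K, hx₀K, -, hKG, -, hF⟩ := exists_isIsometricImmersionOn_comp_symm (by simp)
    (A.isOpen.prod isOpen_univ) A.contDiffOn_ruledExtension (A.contDiffOn_ruledModel hf)
    (fun p hp ↦ A.injective_fderiv_ruledExtension hp.1 (hκ _ hp.1))
    (fun p hp ↦ A.inner_fderiv_ruledModel hf hp.1 (hκ _ hp.1))
    (x₀ := (x₀, 0)) ⟨hx₀, trivial⟩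
  have hO : IsOpen (U ∩ {x | (x, (0 : ℝ)) ∈ K.source}) :=
    A.isOpen.inter (K.open_source.preimage (by fun_prop))
  have hK₀ (x : Euc 2) : K (x, 0) = euclideanProd (x, 0) := by simp [hKG, ruledModel]
  refine ⟨_, Set.inter_subset_left, ⟨hx₀, hx₀K⟩, hf.mono hO Set.inter_subset_left,
    fun x ↦ euclideanProd (x, 0), K.target, A.ruledExtension ∘ K.symm,
    isIsometricImmersionOn_euclideanProd hO, hF, fun x hx ↦ ?_, fun x hx ↦ ?_⟩
  · change euclideanProd (x, 0) ∈ K.target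
    exact hK₀ x ▸ K.map_source hx.2
  · rw [Function.comp_apply, Function.comp_apply, ← hK₀, K.left_inv hx.2]
    simp [ruledExtension]

end PrincipalFrame

/-! ### Regular parametrizations of the surface -/

section Surface

variable {M : Type*} [TopologicalSpace M] [ChartedSpace (Euc 2) M]
  {i : M → Euc 4} {P : Submodule ℝ (Euc 4)} {θ θ' : ℝ}

theorem IsTangentField.mono {V V' : Set M} {Y : M → Euc 4} (h : IsTangentField i V Y)
    (hV' : IsOpen V') (hsub : V' ⊆ V) : IsTangentField i V' Y :=
  ⟨hV', h.contMDiffOn.mono hsub, fun q hq ↦ h.mem_tangentPlane q (hsub hq)⟩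

theorem IsTangentField.mdifferentiableAt {V : Set M} {Y : M → Euc 4} (h : IsTangentField i V Y)
    {p : M} (hp : p ∈ V) : MDifferentiableAt (𝓡 2) 𝓘(ℝ, Euc 4) Y p :=
  (h.contMDiffOn.contMDiffAt (h.isOpen.mem_nhds hp)).mdifferentiableAt (by simp)

theorem IsPrincipalField.mono {V V' : Set M} {T : M → Euc 4} (h : IsPrincipalField i P θ V T)
    (hV' : IsOpen V') (hsub : V' ⊆ V) : IsPrincipalField i P θ V' T :=
  ⟨h.1.mono hV' hsub, fun q hq ↦ h.2 q (hsub hq)⟩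

theorem IsPrincipalField.isPrincipalUnit {V : Set M} {T : M → Euc 4}
    (h : IsPrincipalField i P θ V T) {q : M} (hq : q ∈ V) :
    IsPrincipalUnit (tangentPlane i q) P θ (T q) :=
  h.2 q hq

theorem IsSurfaceImmersion.mdifferentiableAt (hi : IsSurfaceImmersion i) (p : M) :
    MDifferentiableAt (𝓡 2) 𝓘(ℝ, Euc 4) i p :=
  (hi.contMDiff p).mdifferentiableAt (by simp)

/-- `φ` is a smooth map of the open subset `U` of the plane into the surface whose composition with
`i` is an immersion. It need not be injective. -/
structure IsRegularParam (i : M → Euc 4) (φ : Euc 2 → M) (U : Set (Euc 2)) : Prop where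
  isOpen : IsOpen U
  contMDiffOn : ContMDiffOn (𝓡 2) (𝓡 2) ∞ φ U
  injective_fderiv : ∀ x ∈ U, Function.Injective (fderiv ℝ (i ∘ φ) x)

namespace IsRegularParam

variable {φ : Euc 2 → M} {U : Set (Euc 2)}

theorem of_isIsometricImmersionOn (hφ : ContMDiffOn (𝓡 2) (𝓡 2) ∞ φ U)
    (h : IsIsometricImmersionOn (i ∘ φ) U) : IsRegularParam i φ U :=
  ⟨h.1, hφ, fun _ ↦ h.injective_fderiv⟩

theorem chartAt_symm [IsManifold (𝓡 2) ∞ M] (hi : IsSurfaceImmersion i) (p : M) :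
    IsRegularParam i (chartAt (Euc 2) p).symm (chartAt (Euc 2) p).target where
  isOpen := (chartAt (Euc 2) p).open_target
  contMDiffOn := contMDiffOn_chart_symm
  injective_fderiv x hx := by
    have hchart := mdifferentiable_chart (I := 𝓡 2) p
    rw [← mfderiv_eq_fderiv,
      mfderiv_comp x (hi.mdifferentiableAt _) (hchart.mdifferentiableAt_symm hx)]
    exact (hi.injective_mfderiv _).comp (hchart.symm.mfderiv_injective hx)

theorem isOpen_inter_preimage (h : IsRegularParam i φ U) {V : Set M} (hV : IsOpen V) :
    IsOpen (U ∩ φ ⁻¹' V) :=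
  h.contMDiffOn.continuousOn.isOpen_inter_preimage h.isOpen hV

theorem inter_preimage (h : IsRegularParam i φ U) {V : Set M} (hV : IsOpen V) :
    IsRegularParam i φ (U ∩ φ ⁻¹' V) :=
  ⟨h.isOpen_inter_preimage hV, h.contMDiffOn.mono Set.inter_subset_left,
    fun x hx ↦ h.injective_fderiv x hx.1⟩

theorem contDiffOn_comp (h : IsRegularParam i φ U) {V : Set M} {Y : M → Euc 4}
    (hY : ContMDiffOn (𝓡 2) 𝓘(ℝ, Euc 4) ∞ Y V) (hmaps : Set.MapsTo φ U V) :
    ContDiffOn ℝ ∞ (Y ∘ φ) U :=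
  contMDiffOn_iff_contDiffOn.mp (hY.comp h.contMDiffOn hmaps)

theorem exists_equiv (h : IsRegularParam i φ U) (hi : IsSurfaceImmersion i) {x : Euc 2}
    (hx : x ∈ U) : ∃ L : Euc 2 ≃ₗ[ℝ] Euc 2, ∀ Y : M → Euc 4,
      MDifferentiableAt (𝓡 2) 𝓘(ℝ, Euc 4) Y (φ x) →
      ∀ u, fderiv ℝ (Y ∘ φ) x u = surfDeriv Y (φ x) (L u) := by
  have hφ : MDifferentiableAt (𝓡 2) (𝓡 2) φ x :=
    (h.contMDiffOn.contMDiffAt (h.isOpen.mem_nhds hx)).mdifferentiableAt (by simp)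
  let D : Euc 2 →L[ℝ] Euc 2 := mfderiv (𝓡 2) (𝓡 2) φ x
  have chain (Y : M → Euc 4) (hY : MDifferentiableAt (𝓡 2) 𝓘(ℝ, Euc 4) Y (φ x)) (u : Euc 2) :
      fderiv ℝ (Y ∘ φ) x u = surfDeriv Y (φ x) (D u) := by
    rw [← mfderiv_eq_fderiv, mfderiv_comp x hY hφ]
    rfl
  have hD : Function.Injective D := fun u v huv ↦ h.injective_fderiv x hx (by
    rw [chain i (hi.mdifferentiableAt _), chain i (hi.mdifferentiableAt _), huv])
  exact ⟨LinearEquiv.ofInjectiveEndo D hD, chain⟩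

theorem range_fderiv (h : IsRegularParam i φ U) (hi : IsSurfaceImmersion i) {x : Euc 2}
    (hx : x ∈ U) : (fderiv ℝ (i ∘ φ) x).range = tangentPlane i (φ x) := by
  obtain ⟨L, hL⟩ := h.exists_equiv hi hx
  have : (fderiv ℝ (i ∘ φ) x : Euc 2 →ₗ[ℝ] Euc 4) = (surfDeriv i (φ x) : Euc 2 →ₗ[ℝ] Euc 4) ∘ₗ L :=
    LinearMap.ext (hL i (hi.mdifferentiableAt _))
  rw [tangentPlane, this, LinearEquiv.range_comp]

end IsRegularParam

/-! ### Principal fields on the surface -/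

/-- A regular parametrization of a part of the surface on which both principal directions are
spanned by smooth unit fields `T`, `T'`. -/
structure PrincipalParam (i : M → Euc 4) (P : Submodule ℝ (Euc 4)) (θ θ' : ℝ) (φ : Euc 2 → M)
    (U : Set (Euc 2)) (V : Set M) (T T' : M → Euc 4) : Prop where
  immersion : IsSurfaceImmersion i
  generic : GenericAngles θ θ'
  isRegularParam : IsRegularParam i φ U
  mapsTo : Set.MapsTo φ U V
  isPrincipalField : IsPrincipalField i P θ V T
  isPrincipalField' : IsPrincipalField i P θ' V T'

namespace PrincipalParam

variable {φ : Euc 2 → M} {U : Set (Euc 2)} {V : Set M} {T T' : M → Euc 4}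

theorem swap (h : PrincipalParam i P θ θ' φ U V T T') : PrincipalParam i P θ' θ φ U V T' T :=
  ⟨h.immersion, h.generic.swap, h.isRegularParam, h.mapsTo, h.isPrincipalField',
    h.isPrincipalField⟩

theorem range_fderiv (h : PrincipalParam i P θ θ' φ U V T T') {x : Euc 2} (hx : x ∈ U) :
    (fderiv ℝ (i ∘ φ) x).range = tangentPlane i (φ x) :=
  h.isRegularParam.range_fderiv h.immersion hx

/-- The principal frame of `i ∘ φ` consisting of the fields `T ∘ φ` and `T' ∘ φ`. -/
def frame (h : PrincipalParam i P θ θ' φ U V T T') : PrincipalFrame (i ∘ φ) U P θ θ' where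
  T := T ∘ φ
  T' := T' ∘ φ
  generic := h.generic
  isOpen := h.isRegularParam.isOpen
  contDiffOn := h.isRegularParam.contDiffOn_comp h.immersion.contMDiff.contMDiffOn
    (Set.mapsTo_univ φ U)
  injective_fderiv := h.isRegularParam.injective_fderiv
  contDiffOn_T := h.isRegularParam.contDiffOn_comp h.isPrincipalField.1.contMDiffOn h.mapsTo
  contDiffOn_T' := h.isRegularParam.contDiffOn_comp h.isPrincipalField'.1.contMDiffOn h.mapsTo
  isPrincipalUnit _ hx := h.range_fderiv hx ▸ h.isPrincipalField.isPrincipalUnit (h.mapsTo hx)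
  isPrincipalUnit' _ hx := h.range_fderiv hx ▸ h.isPrincipalField'.isPrincipalUnit (h.mapsTo hx)

variable (h : PrincipalParam i P θ θ' φ U V T T') {x : Euc 2} (hx : x ∈ U)
include h hx

theorem starProjection_fderiv (u : Euc 2) :
    (tangentPlane i (φ x)).starProjection (fderiv ℝ (T ∘ φ) x u) =
      -h.frame.connForm x u • T' (φ x) := by
  rw [show fderiv ℝ (T ∘ φ) x u = _ from h.frame.fderiv_T hx u]
  refine Submodule.eq_starProjection_of_mem_orthogonal
    (Submodule.smul_mem _ _ (h.isPrincipalField'.isPrincipalUnit (h.mapsTo hx)).mem) ?_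
  rw [← h.range_fderiv hx]
  rintro _ ⟨v, rfl⟩
  rw [show T' (φ x) = h.frame.T' x from rfl, add_sub_cancel_left, real_inner_smul_right]
  exact mul_eq_zero_of_right _ (h.frame.swap.inner_fderiv_N hx v)

theorem geodesic_iff : (∀ v, surfDeriv i (φ x) v = T (φ x) → leviCivita i T (φ x) v = 0) ↔
    h.frame.curvature x = 0 := by
  obtain ⟨L, hL⟩ := h.isRegularParam.exists_equiv h.immersion hx
  have hvec (v : Euc 2) : surfDeriv i (φ x) v = T (φ x) ↔ v = L (h.frame.vec x) := by
    rw [show T (φ x) = _ from (h.frame.fderiv_apply_vec hx).symm,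
      hL i (h.immersion.mdifferentiableAt _)]
    exact (h.immersion.injective_mfderiv (φ x)).eq_iff
  have hT' : T' (φ x) ≠ 0 := norm_ne_zero_iff.mp ((h.frame.swap.norm_T hx).trans_ne one_ne_zero)
  simp only [hvec, forall_eq]
  rw [leviCivita, ← hL T (h.isPrincipalField.1.mdifferentiableAt (h.mapsTo hx)),
    h.starProjection_fderiv hx, h.frame.connForm_vec hx]
  simp [hT', h.generic.angleCoeff_ne_zero]

theorem secondFundForm_eq {V' : Set M} {Y : M → Euc 4} (hxV' : φ x ∈ V')
    (hY : IsTangentField i V' Y) {L : Euc 2 ≃ₗ[ℝ] Euc 2}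
    (hL : ∀ Y : M → Euc 4, MDifferentiableAt (𝓡 2) 𝓘(ℝ, Euc 4) Y (φ x) →
      ∀ u, fderiv ℝ (Y ∘ φ) x u = surfDeriv Y (φ x) (L u)) (u : Euc 2) :
    secondFundForm i Y (φ x) (L u) =
      (h.frame.coframe x u * ⟪T (φ x), Y (φ x)⟫) • h.frame.curvature x • h.frame.swap.N x +
        (h.frame.swap.coframe x u * ⟪T' (φ x), Y (φ x)⟫) •
          h.frame.swap.curvature x • h.frame.N x := by
  have hparam := h.isRegularParam.inter_preimage hY.isOpen
  have hmem : U ∩ φ ⁻¹' V' ∈ 𝓝 x := hparam.isOpen.mem_nhds ⟨hx, hxV'⟩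
  simp only [secondFundForm, ← hL Y (hY.mdifferentiableAt hxV'), ← h.range_fderiv hx]
  refine h.frame.starProjection_orthogonal_fderiv_of_mem_range hx
    (differentiableAt_of_contDiffAt_infty
      ((hparam.contDiffOn_comp hY.contMDiffOn fun y hy ↦ hy.2).contDiffAt hmem)) ?_ u
  filter_upwards [hmem] with y hy
  rw [h.range_fderiv hy.1]
  exact hY.mem_tangentPlane _ hy.2

theorem curvature_smul_mem_firstNormalSpace :
    h.frame.curvature x • h.frame.swap.N x ∈ firstNormalSpace i (φ x) := by
  obtain ⟨L, hL⟩ := h.isRegularParam.exists_equiv h.immersion hx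
  refine Submodule.subset_span ⟨V, T, L (h.frame.vec x), h.mapsTo hx, h.isPrincipalField.1, ?_⟩
  rw [h.secondFundForm_eq hx (h.mapsTo hx) h.isPrincipalField.1 hL, h.frame.coframe_vec hx,
    h.frame.swap_coframe_vec hx, (h.isPrincipalField.isPrincipalUnit (h.mapsTo hx)).inner_self]
  simp

theorem firstNormalSpace_eq : firstNormalSpace i (φ x) = Submodule.span ℝ
    {h.frame.curvature x • h.frame.swap.N x, h.frame.swap.curvature x • h.frame.N x} := by
  apply le_antisymm
  · obtain ⟨L, hL⟩ := h.isRegularParam.exists_equiv h.immersion hx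
    refine Submodule.span_le.mpr ?_
    rintro _ ⟨V', Y, v, hxV', hY, rfl⟩
    refine Submodule.mem_span_pair.mpr ⟨_, _, (L.apply_symm_apply v ▸
      h.secondFundForm_eq hx hxV' hY hL (L.symm v)).symm⟩
  · rw [Submodule.span_le, Set.pair_subset_iff]
    exact ⟨h.curvature_smul_mem_firstNormalSpace hx, h.swap.curvature_smul_mem_firstNormalSpace hx⟩

theorem firstNormalSpace_eq_bot_iff : firstNormalSpace i (φ x) = ⊥ ↔
    h.frame.curvature x = 0 ∧ h.frame.swap.curvature x = 0 := by
  have hN : h.frame.N x ≠ 0 := norm_ne_zero_iff.mp ((h.frame.norm_N hx).trans_ne one_ne_zero)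
  have hN' : h.frame.swap.N x ≠ 0 :=
    norm_ne_zero_iff.mp ((h.frame.swap.norm_N hx).trans_ne one_ne_zero)
  rw [h.firstNormalSpace_eq hx, Submodule.span_eq_bot]
  simp [hN, hN']

theorem finrank_firstNormalSpace_eq_one_iff (hne : firstNormalSpace i (φ x) ≠ ⊥) :
    Module.finrank ℝ (firstNormalSpace i (φ x)) = 1 ↔
      h.frame.curvature x = 0 ∨ h.frame.swap.curvature x = 0 := by
  constructor
  · intro hfinrank
    have hN : h.frame.N x ≠ 0 := norm_ne_zero_iff.mp ((h.frame.norm_N hx).trans_ne one_ne_zero)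
    have hN' : h.frame.swap.N x ≠ 0 :=
      norm_ne_zero_iff.mp ((h.frame.swap.norm_N hx).trans_ne one_ne_zero)
    have hmem : h.frame.swap.curvature x • h.frame.N x ∈ firstNormalSpace i (φ x) :=
      h.swap.curvature_smul_mem_firstNormalSpace hx
    have horth : ⟪h.frame.swap.N x, h.frame.N x⟫ = 0 := h.frame.swap.inner_N_N' hx
    exact (eq_zero_or_eq_zero_of_finrank_eq_one hfinrank
      (h.curvature_smul_mem_firstNormalSpace hx) hmem
      (by rw [real_inner_smul_left, real_inner_smul_right, horth, mul_zero, mul_zero])).imp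
      (fun h₀ ↦ (smul_eq_zero.mp h₀).resolve_right hN')
      fun h₀ ↦ (smul_eq_zero.mp h₀).resolve_right hN
  · have hspan := h.firstNormalSpace_eq hx
    have line {z : Euc 4} (hz : firstNormalSpace i (φ x) = Submodule.span ℝ {z}) :
        Module.finrank ℝ (firstNormalSpace i (φ x)) = 1 := by
      rw [hz] at hne ⊢
      exact finrank_span_singleton (Submodule.span_singleton_eq_bot.not.mp hne)
    rintro (hκ | hκ)
    · rw [hκ, zero_smul, Submodule.span_insert_zero] at hspan
      exact line hspan
    · rw [hκ, zero_smul, Set.pair_comm, Submodule.span_insert_zero] at hspan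
      exact line hspan

end PrincipalParam
end Surface

/-! ### Existence of principal fields -/

theorem exists_contDiffOn_isPrincipalUnit {f : Euc 2 → Euc 4} {U : Set (Euc 2)}
    {P : Submodule ℝ (Euc 4)} {θ θ' : ℝ} (hU : IsOpen U) (hf : ContDiffOn ℝ ∞ f U)
    (hinj : ∀ x ∈ U, Function.Injective (fderiv ℝ f x)) (hθ : Real.cos θ ^ 2 ≠ Real.cos θ' ^ 2)
    (hT : ∀ x ∈ U, ∃ T, IsPrincipalUnit (fderiv ℝ f x).range P θ T)
    (hT' : ∀ x ∈ U, ∃ T, IsPrincipalUnit (fderiv ℝ f x).range P θ' T) {x₀ : Euc 2} (hx₀ : x₀ ∈ U) :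
    ∃ (O : Set (Euc 2)) (T : Euc 2 → Euc 4), O ⊆ U ∧ IsOpen O ∧ x₀ ∈ O ∧ ContDiffOn ℝ ∞ T O ∧
      ∀ x ∈ O, IsPrincipalUnit (fderiv ℝ f x).range P θ (T x) := by
  obtain ⟨T₀, hT₀⟩ := hT x₀ hx₀
  obtain ⟨u, hu⟩ := hT₀.mem
  -- Applying `S - cos² θ'` to the tangent field `df u` kills its `θ'`-component.
  let q (x : Euc 2) : Euc 4 := (fderiv ℝ f x).range.starProjection
    (P.starProjection (fderiv ℝ f x u)) - Real.cos θ' ^ 2 • fderiv ℝ f x u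
  have hq {x : Euc 2} (hx : x ∈ U) {T : Euc 4} (hT : IsPrincipalUnit (fderiv ℝ f x).range P θ T) :
      q x = ((Real.cos θ ^ 2 - Real.cos θ' ^ 2) * ⟪T, fderiv ℝ f x u⟫) • T := by
    obtain ⟨T', hT'⟩ := hT' x hx
    refine hT.starProjection_sub_smul hT' hθ ?_ ⟨u, rfl⟩
    rw [LinearMap.finrank_range_of_inj (hinj x hx), finrank_euclideanSpace_fin]
  have hq_smooth : ContDiffOn ℝ ∞ q U := by
    intro x hx
    have hdf := contDiffAt_infty_fderiv (hf.contDiffAt (hU.mem_nhds hx))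
    have hproj := contDiffAt_starProjection_range hdf
      (Filter.eventually_of_mem (hU.mem_nhds hx) hinj)
    have hdfu := hdf.clm_apply (contDiffAt_const (c := u))
    exact ((hproj.clm_apply (P.starProjection.contDiff.contDiffAt.comp x hdfu)).sub
      (hdfu.const_smul (Real.cos θ' ^ 2))).contDiffWithinAt
  have hq_smooth' := hq_smooth.mono (Set.inter_subset_left : U ∩ q ⁻¹' {0}ᶜ ⊆ U)
  refine ⟨U ∩ q ⁻¹' {0}ᶜ, fun x ↦ ‖q x‖⁻¹ • q x, Set.inter_subset_left,
    hq_smooth.continuousOn.isOpen_inter_preimage hU isOpen_compl_singleton, ⟨hx₀, ?_⟩,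
    ((hq_smooth'.norm ℝ fun x hx ↦ hx.2).inv fun x hx ↦ norm_ne_zero_iff.mpr hx.2).smul hq_smooth',
    fun x hx ↦ ?_⟩
  · have hu : fderiv ℝ f x₀ u = T₀ := hu
    have hT₀0 : T₀ ≠ 0 := norm_ne_zero_iff.mp (hT₀.1.trans_ne one_ne_zero)
    simp [hq hx₀ hT₀, hu, sub_eq_zero, hθ, hT₀0]
  · obtain ⟨T, hT⟩ := hT x hx.1
    have hqx := hq hx.1 hT
    simp only [hqx]
    exact hT.normalize_smul fun hc ↦ hx.2 (by rw [Set.mem_singleton_iff, hqx, hc, zero_smul])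

section Surface

variable {M : Type*} [TopologicalSpace M] [ChartedSpace (Euc 2) M]
  {i : M → Euc 4} {P : Submodule ℝ (Euc 4)} {θ θ' : ℝ}

/-- The immersed surface has everywhere principal vectors for the constant angles `θ`, `θ'`
with the plane `P`. The two angles are not ordered, so that they can be exchanged. -/
structure ConstantAngles (i : M → Euc 4) (P : Submodule ℝ (Euc 4)) (θ θ' : ℝ) : Prop where
  immersion : IsSurfaceImmersion i
  generic : GenericAngles θ θ'
  exists_isPrincipalUnit : ∀ p, ∃ T, IsPrincipalUnit (tangentPlane i p) P θ T
  exists_isPrincipalUnit' : ∀ p, ∃ T, IsPrincipalUnit (tangentPlane i p) P θ' T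

/-- The points near which the principal field of the angle `θ` is geodesic. -/
def geodesicLocus (i : M → Euc 4) (P : Submodule ℝ (Euc 4)) (θ : ℝ) : Set M :=
  {p | ∃ (V : Set M) (T : M → Euc 4), p ∈ V ∧ IsPrincipalField i P θ V T ∧ IsGeodesicField i V T}

theorem isOpen_geodesicLocus : IsOpen (geodesicLocus i P θ) :=
  isOpen_iff_mem_nhds.mpr fun _ ⟨V, T, hp, hT, hgeod⟩ ↦
    Filter.mem_of_superset (hT.1.isOpen.mem_nhds hp) fun _ hq ↦ ⟨V, T, hq, hT, hgeod⟩

theorem chartAt_mem_target_inter_preimage {p : M} {V : Set M} (hp : p ∈ V) :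
    chartAt (Euc 2) p p ∈ (chartAt (Euc 2) p).target ∩ (chartAt (Euc 2) p).symm ⁻¹' V := by
  refine ⟨mem_chart_target _ p, ?_⟩
  rwa [Set.mem_preimage, (chartAt (Euc 2) p).left_inv (mem_chart_source _ p)]

namespace ConstantAngles

theorem swap (h : ConstantAngles i P θ θ') : ConstantAngles i P θ' θ :=
  ⟨h.immersion, h.generic.swap, h.exists_isPrincipalUnit', h.exists_isPrincipalUnit⟩

variable (h : ConstantAngles i P θ θ')
include h

theorem principalParam {φ : Euc 2 → M} {U : Set (Euc 2)} (hφ : IsRegularParam i φ U)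
    {V V' : Set M} {T T' : M → Euc 4} (hT : IsPrincipalField i P θ V T)
    (hT' : IsPrincipalField i P θ' V' T') :
    PrincipalParam i P θ θ' φ (U ∩ φ ⁻¹' (V ∩ V')) (V ∩ V') T T' :=
  have hV := hT.1.isOpen.inter hT'.1.isOpen
  ⟨h.immersion, h.generic, hφ.inter_preimage hV, fun _ hx ↦ hx.2,
    hT.mono hV Set.inter_subset_left, hT'.mono hV Set.inter_subset_right⟩

variable [IsManifold (𝓡 2) ∞ M]

theorem exists_isPrincipalField (p : M) :
    ∃ (V : Set M) (T : M → Euc 4), p ∈ V ∧ IsPrincipalField i P θ V T := by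
  let e := chartAt (Euc 2) p
  have hparam : IsRegularParam i e.symm e.target := .chartAt_symm h.immersion p
  have hrange {x : Euc 2} (hx : x ∈ e.target) := hparam.range_fderiv h.immersion hx
  obtain ⟨O, T, hO, hO_open, hpO, hT, hunit⟩ := exists_contDiffOn_isPrincipalUnit
    hparam.isOpen (hparam.contDiffOn_comp h.immersion.contMDiff.contMDiffOn (Set.mapsTo_univ _ _))
    hparam.injective_fderiv h.generic.cos_sq_ne
    (fun x hx ↦ by rw [hrange hx]; exact h.exists_isPrincipalUnit _)
    (fun x hx ↦ by rw [hrange hx]; exact h.exists_isPrincipalUnit' _) (mem_chart_target _ p)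
  have hunit {q : M} (hq : q ∈ e.source ∩ e ⁻¹' O) :
      IsPrincipalUnit (tangentPlane i q) P θ (T (e q)) := by
    simpa only [hrange (hO hq.2), e.left_inv hq.1] using hunit (e q) hq.2
  have he : ContMDiffOn (𝓡 2) (𝓡 2) ∞ e e.source := contMDiffOn_chart
  exact ⟨e.source ∩ e ⁻¹' O, T ∘ e, ⟨mem_chart_source _ p, hpO⟩,
    ⟨e.isOpen_inter_preimage hO_open,
      hT.contMDiffOn.comp (he.mono Set.inter_subset_left) fun _ hq ↦ hq.2,
      fun _ hq ↦ (hunit hq).mem⟩, fun _ hq ↦ hunit hq⟩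

theorem finrank_firstNormalSpace_of_isSurfaceComposition (hN : ∀ p, firstNormalSpace i p ≠ ⊥)
    (hcomp : IsSurfaceComposition i) (p : M) : Module.finrank ℝ (firstNormalSpace i p) = 1 := by
  obtain ⟨U, φ, hφ, ⟨x, hxU, rfl⟩, hcomp⟩ := hcomp p
  obtain ⟨V, T, hxV, hT⟩ := h.exists_isPrincipalField (φ x)
  obtain ⟨V', T', hxV', hT'⟩ := h.swap.exists_isPrincipalField (φ x)
  have hparam := h.principalParam (.of_isIsometricImmersionOn hφ hcomp.1) hT hT'
  have hx : x ∈ U ∩ φ ⁻¹' (V ∩ V') := ⟨hxU, hxV, hxV'⟩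
  obtain ⟨hisom, g, W, F, hg, hF, hmaps, heq⟩ :=
    hcomp.mono hparam.isRegularParam.isOpen Set.inter_subset_left
  exact (hparam.finrank_firstNormalSpace_eq_one_iff hx (hN _)).mpr
    (IsFactorization.curvature_eq_zero_or ⟨hisom, hF, hg, hmaps, heq⟩ hparam.frame hx)

theorem isSurfaceComposition_of_principalDirectionGeodesic
    (hgeod : PrincipalDirectionGeodesic i P θ) : IsSurfaceComposition i := by
  intro p
  obtain ⟨V, T, hpV, hT, hgeod⟩ := hgeod p
  obtain ⟨V', T', hpV', hT'⟩ := h.swap.exists_isPrincipalField p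
  have curvature_eq_zero {φ : Euc 2 → M} {U : Set (Euc 2)} (hφ : IsRegularParam i φ U) :
      ∀ x ∈ U ∩ φ ⁻¹' (V ∩ V'), (h.principalParam hφ hT hT').frame.curvature x = 0 := fun x hx ↦
    ((h.principalParam hφ hT hT').geodesic_iff hx).mp (hgeod _ hx.2.1)
  let e := chartAt (Euc 2) p
  have hep : e.symm (e p) = p := e.left_inv (mem_chart_source _ p)
  have hchart : IsRegularParam i e.symm e.target := .chartAt_symm h.immersion p
  obtain ⟨ψ, O, hψ, hmaps, ⟨y, hyO, hy⟩, hisom⟩ :=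
    (h.principalParam hchart hT hT').frame.exists_isometric_reparametrization
      (curvature_eq_zero hchart) (chartAt_mem_target_inter_preimage ⟨hpV, hpV'⟩)
  have hyp : (e.symm ∘ ψ) y = p := by rw [Function.comp_apply, hy, hep]
  have hφ : ContMDiffOn (𝓡 2) (𝓡 2) ∞ (e.symm ∘ ψ) O :=
    hchart.contMDiffOn.comp hψ.contMDiffOn fun z hz ↦ (hmaps hz).1
  have hparam : IsRegularParam i (e.symm ∘ ψ) O := .of_isIsometricImmersionOn hφ hisom
  obtain ⟨O', hO', hyO', hcomp⟩ := (h.principalParam hparam hT hT').frame.exists_isCompositionOn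
    (hisom.mono (h.principalParam hparam hT hT').isRegularParam.isOpen Set.inter_subset_left)
    (curvature_eq_zero hparam) (x₀ := y) ⟨hyO, by rw [Set.mem_preimage, hyp]; exact ⟨hpV, hpV'⟩⟩
  exact ⟨O', e.symm ∘ ψ, hφ.mono (hO'.trans Set.inter_subset_left), ⟨y, hyO', hyp⟩, hcomp⟩

theorem notMem_geodesicLocus_of_mem {p : M} (hN : firstNormalSpace i p ≠ ⊥)
    (hp : p ∈ geodesicLocus i P θ) : p ∉ geodesicLocus i P θ' := by
  rintro ⟨V', T', hpV', hT', hgeod'⟩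
  obtain ⟨V, T, hpV, hT, hgeod⟩ := hp
  have hparam := h.principalParam (.chartAt_symm h.immersion p) hT hT'
  have hep := (chartAt (Euc 2) p).left_inv (mem_chart_source _ p)
  have hx := chartAt_mem_target_inter_preimage (V := V ∩ V') ⟨hpV, hpV'⟩
  refine hN (hep ▸ (hparam.firstNormalSpace_eq_bot_iff hx).mpr
    ⟨(hparam.geodesic_iff hx).mp (hgeod _ hx.2.1),
      (hparam.swap.geodesic_iff hx).mp (hgeod' _ hx.2.2)⟩)

/-- The nonzero curvature persists nearby; since `N₁` is a line, the other curvature vanishes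
there. -/
theorem mem_geodesicLocus_of_curvature_ne_zero
    (hN : ∀ p, Module.finrank ℝ (firstNormalSpace i p) = 1) {V V' : Set M} {T T' : M → Euc 4}
    {p : M} (hp : p ∈ V ∩ V') (hT : IsPrincipalField i P θ V T)
    (hT' : IsPrincipalField i P θ' V' T')
    (hκ : (h.principalParam (.chartAt_symm h.immersion p) hT hT').frame.swap.curvature
      (chartAt (Euc 2) p p) ≠ 0) : p ∈ geodesicLocus i P θ := by
  let e := chartAt (Euc 2) p
  let hparam := h.principalParam (.chartAt_symm h.immersion p) hT hT'
  have hx := chartAt_mem_target_inter_preimage hp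
  obtain ⟨O, hO, hO_open, hpO⟩ := mem_nhds_iff.mp
    ((hparam.frame.swap.eventually_curvature_ne_zero hx hκ).and (hparam.frame.isOpen.mem_nhds hx))
  have hsub : e.source ∩ e ⁻¹' O ⊆ V ∩ V' := fun q hq ↦ e.left_inv hq.1 ▸ (hO hq.2).2.2
  refine ⟨e.source ∩ e ⁻¹' O, T, ⟨mem_chart_source _ p, hpO⟩,
    hT.mono (e.isOpen_inter_preimage hO_open) (hsub.trans Set.inter_subset_left), fun q hq ↦ ?_⟩
  obtain ⟨hκ', hxU⟩ := hO hq.2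
  have hκ₀ := (hparam.finrank_firstNormalSpace_eq_one_iff hxU
    (Submodule.one_le_finrank_iff.mp (hN _).ge)).mp (hN _)
  have hgeod := (hparam.geodesic_iff hxU).mpr (hκ₀.resolve_right hκ')
  rwa [e.left_inv hq.1] at hgeod

theorem mem_geodesicLocus_or (hN : ∀ p, Module.finrank ℝ (firstNormalSpace i p) = 1) (p : M) :
    p ∈ geodesicLocus i P θ ∨ p ∈ geodesicLocus i P θ' := by
  obtain ⟨V, T, hpV, hT⟩ := h.exists_isPrincipalField p
  obtain ⟨V', T', hpV', hT'⟩ := h.swap.exists_isPrincipalField p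
  have hparam := h.principalParam (.chartAt_symm h.immersion p) hT hT'
  have hx := chartAt_mem_target_inter_preimage (V := V ∩ V') ⟨hpV, hpV'⟩
  by_contra! hp
  refine Submodule.one_le_finrank_iff.mp (hN _).ge
    ((hparam.firstNormalSpace_eq_bot_iff hx).mpr ⟨?_, ?_⟩)
  · by_contra hκ
    exact hp.2 (h.swap.mem_geodesicLocus_of_curvature_ne_zero hN ⟨hpV', hpV⟩ hT' hT hκ)
  · by_contra hκ
    exact hp.1 (h.mem_geodesicLocus_of_curvature_ne_zero hN ⟨hpV, hpV'⟩ hT hT' hκ)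

theorem principalDirectionGeodesic_or [ConnectedSpace M]
    (hN : ∀ p, Module.finrank ℝ (firstNormalSpace i p) = 1) :
    PrincipalDirectionGeodesic i P θ ∨ PrincipalDirectionGeodesic i P θ' := by
  have hcompl : (geodesicLocus i P θ)ᶜ = geodesicLocus i P θ' := Set.ext fun p ↦
    ⟨(h.mem_geodesicLocus_or hN p).resolve_left, h.swap.notMem_geodesicLocus_of_mem
      (Submodule.one_le_finrank_iff.mp (hN p).ge)⟩
  have hclopen : IsClopen (geodesicLocus i P θ) :=
    ⟨⟨hcompl ▸ isOpen_geodesicLocus⟩, isOpen_geodesicLocus⟩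
  rcases isClopen_iff.mp hclopen with hempty | huniv
  · rw [hempty, Set.compl_empty] at hcompl
    exact .inr fun p ↦ hcompl.subset (Set.mem_univ p)
  · exact .inl fun p ↦ huniv.ge (Set.mem_univ p)

end ConstantAngles
end Surface

end

theorem mainTheorem8 {M : Type*} [TopologicalSpace M] [ChartedSpace (Euc 2) M]
    [IsManifold (𝓡 2) ∞ M] [ConnectedSpace M]
    (i : M → Euc 4) (hi : IsSurfaceImmersion i)
    (P : Submodule ℝ (Euc 4)) (hP : Module.finrank ℝ P = 2)
    (θ₁ θ₂ : ℝ) (h₁ : 0 < θ₁) (h₁₂ : θ₁ < θ₂) (h₂ : θ₂ < Real.pi / 2)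
    (hangles : ∀ p, ArePrincipalAngles (tangentPlane i p) P θ₁ θ₂)
    (hN : ∀ p, firstNormalSpace i p ≠ ⊥) :
    List.TFAE [
      IsSurfaceComposition i,
      ∀ p, Module.finrank ℝ (firstNormalSpace i p) = 1,
      PrincipalDirectionGeodesic i P θ₁ ∨ PrincipalDirectionGeodesic i P θ₂] := by
  have hconst : ConstantAngles i P θ₁ θ₂ :=
    ⟨hi, .of_pos_of_lt_of_lt_pi_div_two h₁ h₁₂ h₂, fun p ↦ (hangles p).exists_isPrincipalUnit.1,
      fun p ↦ (hangles p).exists_isPrincipalUnit.2⟩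
  tfae_have 1 → 2 := hconst.finrank_firstNormalSpace_of_isSurfaceComposition hN
  tfae_have 2 → 3 := hconst.principalDirectionGeodesic_or
  tfae_have 3 → 1 := fun h ↦ h.elim hconst.isSurfaceComposition_of_principalDirectionGeodesic
    hconst.swap.isSurfaceComposition_of_principalDirectionGeodesic
  tfae_finish
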